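/- Let $S$ be a compact connected surface with non-empty boundary $\partial S$ (that is, a compact connected Hausdorff topological $2$-manifold with boundary, with $\partial S\neq\emptyset$). Let the relative chromatic number $c_0(S)\in\mathbb N\cup\{\infty\}$ be the supremum of the chromatic numbers of the finite graphs that admit an embedding in $S$ sending every vertex to a point of $\partial S$. A polyhedral embedding $\varphi:S\to\mathbb R^n$ is a topological embedding whose image is the union of the simplices of a finite simplicial complex in $\mathbb R^n$. It is substantial if its image is not contained in any affine hyperplane, equivalently if the affine span of $\varphi(S)$ is $\mathbb R^n$. It is tight if for every integer $p\ge 0$ and every open affine half-space $E\subset\mathbb R^n$ the map $H_p(\varphi(S)\cap E;\mathbb Z/2)\to H_p(\varphi(S);\mathbb Z/2)$ induced by inclusion in singular homology is injective. Theorem. If $S$ admits a polyhedral, substantial and tight embedding into $\mathbb R^n$, then $n\le c_0(S)-1$, that is, $n+1\le c_0(S)$. -/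

import Mathlib

open scoped Manifold

noncomputable section

namespace TightSurface

/-- An embedding of a graph `G` in a topological space `X`: the vertices go to distinct points,
each edge goes to a simple arc joining the images of its ends, an arc passes through no vertex
other than its two ends, and the arcs of two different edges meet only in vertices (hence only in
common ends). For a finite graph and a Hausdorff space this is the same as a topological embedding
of the geometric realization of `G` in `X`. -/
structure GraphEmbedding {V : Type*} (G : SimpleGraph V) (X : Type*) [TopologicalSpace X] where
  vertex : V → X
  vertex_injective : Function.Injective vertex
  /-- the arc of an edge, parametrized from `a` to `b` -/
  arc : ∀ {a b : V}, G.Adj a b → Path (vertex a) (vertex b)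
  /-- the same edge seen from its other end is the same arc run backwards -/
  arc_symm : ∀ {a b : V} (h : G.Adj a b), arc h.symm = (arc h).symm
  arc_injective : ∀ {a b : V} (h : G.Adj a b), Function.Injective (arc h)
  arc_vertex : ∀ {a b : V} (h : G.Adj a b) (c : V),
    vertex c ∈ Set.range (arc h) → c = a ∨ c = b
  arc_inter : ∀ {a b c d : V} (h : G.Adj a b) (h' : G.Adj c d), s(a, b) ≠ s(c, d) →
    Set.range (arc h) ∩ Set.range (arc h') ⊆ Set.range vertex

/-- `G` has a proper embedding in the surface `S`: an embedding that sends every vertex to the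
boundary of `S`. -/
def ProperlyEmbeds {V : Type*} (G : SimpleGraph V) (S : Type*) [TopologicalSpace S]
    [ChartedSpace (EuclideanHalfSpace 2) S] : Prop :=
  ∃ f : GraphEmbedding G S, ∀ v : V, f.vertex v ∈ (𝓡∂ 2).boundary S

/-- The relative chromatic number of `S`: the supremum (in `ℕ ∪ {∞}`) of the chromatic numbers of
the finite graphs that have a proper embedding in `S`. Every finite graph is isomorphic to one with
vertex set `Fin k`. -/
def relativeChromaticNumber (S : Type*) [TopologicalSpace S]
    [ChartedSpace (EuclideanHalfSpace 2) S] : ℕ∞ :=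
  ⨆ (k : ℕ) (G : SimpleGraph (Fin k)) (_ : ProperlyEmbeds G S), G.chromaticNumber

/-- The map `H_p(A) → H_p(B)` induced by the inclusion of a subspace `A ⊆ B`, in singular homology
with coefficients in `ℤ/2ℤ`. -/
def homologyInclusion {X : Type} [TopologicalSpace X] {A B : Set X} (h : A ⊆ B) (p : ℕ) :
    ((AlgebraicTopology.singularHomologyFunctor (ModuleCat.{0} (ZMod 2)) p).obj
        (ModuleCat.of (ZMod 2) (ZMod 2))).obj (TopCat.of A) ⟶
      ((AlgebraicTopology.singularHomologyFunctor (ModuleCat.{0} (ZMod 2)) p).obj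
        (ModuleCat.of (ZMod 2) (ZMod 2))).obj (TopCat.of B) :=
  ((AlgebraicTopology.singularHomologyFunctor (ModuleCat.{0} (ZMod 2)) p).obj
    (ModuleCat.of (ZMod 2) (ZMod 2))).map
      (TopCat.ofHom ⟨Set.inclusion h, continuous_inclusion h⟩)

/-- The open affine half-space `{x | c < ⟪v, x⟫}` (for `v ≠ 0`). -/
def openHalfSpace {n : ℕ} (v : EuclideanSpace ℝ (Fin n)) (c : ℝ) :
    Set (EuclideanSpace ℝ (Fin n)) :=
  {x | c < inner ℝ v x}

/-- A map `φ` to `ℝⁿ` is `p`-tight if, for every open affine half-space `E`, the inclusion induces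
an injection from `H_p(φ(S) ∩ E)` to `H_p(φ(S))`. -/
def IsPTight {S : Type*} {n : ℕ} (p : ℕ) (φ : S → EuclideanSpace ℝ (Fin n)) : Prop :=
  ∀ (v : EuclideanSpace ℝ (Fin n)) (c : ℝ), v ≠ 0 →
    Function.Injective (homologyInclusion
      (Set.inter_subset_left : Set.range φ ∩ openHalfSpace v c ⊆ Set.range φ) p)

def IsTight {S : Type*} {n : ℕ} (φ : S → EuclideanSpace ℝ (Fin n)) : Prop :=
  ∀ p : ℕ, IsPTight p φ

/-- The image of `φ` is not contained in any affine hyperplane, that is, it affinely spans `ℝⁿ`. -/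
def IsSubstantial {S : Type*} {n : ℕ} (φ : S → EuclideanSpace ℝ (Fin n)) : Prop :=
  affineSpan ℝ (Set.range φ) = ⊤

/-- A polyhedral embedding: a topological embedding whose image is the union of the simplices of a
finite (geometric) simplicial complex in `ℝⁿ`. -/
def IsPolyhedralEmbedding {S : Type*} [TopologicalSpace S] {n : ℕ}
    (φ : S → EuclideanSpace ℝ (Fin n)) : Prop :=
  Topology.IsEmbedding φ ∧
    ∃ K : Geometry.SimplicialComplex ℝ (EuclideanSpace ℝ (Fin n)),
      K.faces.Finite ∧ K.space = Set.range φ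

end TightSurface

end

/-!
Let `M = φ(S)` be the image of a tight polyhedral embedding, `V` the finite set of vertices of the
underlying complex and `P` the convex hull of `V`, an `n`-dimensional polytope because the
embedding is substantial. The complete graph on `n + 1` vertices, which has chromatic number
`n + 1`, is shown to embed in `S` with all its vertices on the boundary; this rests on three facts.

* *The graph of a polytope* (`exists_completeGraph_skeleton`, a theorem of Grünbaum). The
  `1`-skeleton of a polytope of dimension at least `m` contains an embedded complete graph on
  `m + 1` vertices, all of which are vertices of the polytope. The proof is by induction: a complete
  graph in the vertex figure at a vertex `v` is pushed radially from `v` to the far side of the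
  polytope, and is then coned off by edges from `v`. Skeleta are described without a face lattice,
  by the dimension of the space `faceDir P x` of directions in which `x` can be moved both ways
  within `P`. The radial map is continuous because the far side is compact (`isCompact_farSide`).

* *Edges of `P` lie in `M`* (`skeleton_one_subset`). By `0`-tightness the part of the connected
  set `M` in an open half-space is connected, hence so is the part of `M` in a supporting
  hyperplane of `P`. For an edge this part is a connected subset of a line that contains the two
  ends.

* *Vertices of `P` are images of boundary points* (`mem_boundary_of_mem_skeleton_zero`). Suppose
  that an interior point `x` is mapped to a vertex. A small loop around `x` contracts in a chart,
  and by `1`-tightness it already bounds in a half-space that misses the vertex, hence in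
  `S ∖ {x}` (`loopsBound_of_isPTight`). In a connected surface with boundary this is impossible
  (`not_loopsBound`): homeomorphisms supported in charts show that the points with this property
  fill a component of the interior, but near a boundary point there is a map from `S ∖ {x}` to the
  circle, constant outside a strip that joins `x` to the boundary, of degree one on small loops
  around `x` (`exists_nhds_not_loopsBound`).

The only homology computed is `H₁(S¹; ℤ/2ℤ) ≠ 0` (`homologyMap_one_id_circle_ne_zero`), by means
of an explicit cocycle that counts the turns of a lift to the real line.
-/

open scoped Manifold

noncomputable section

namespace TightSurface

/-! ### Singular homology with coefficients in `ℤ/2ℤ` -/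

section Homology

open CategoryTheory Simplicial AlgebraicTopology Limits

/-- Evaluating a cocycle on the image of a cycle depends only on the map induced in homology. -/
theorem cycle_comp_cocycle_eq_of_homologyMap_eq {C : Type*} [Category C] [Abelian C]
    {K L : ChainComplex C ℕ} {α β : K ⟶ L} {n : ℕ}
    (h : HomologicalComplex.homologyMap α n = HomologicalComplex.homologyMap β n) {A B : C}
    (z : A ⟶ K.X n) (hz : ∀ m, z ≫ K.d n m = 0) (φ : L.X n ⟶ B) (hφ : ∀ m, L.d m n ≫ φ = 0) :
    z ≫ α.f n ≫ φ = z ≫ β.f n ≫ φ := by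
  have key : ∀ γ : K ⟶ L, z ≫ γ.f n ≫ φ = K.liftCycles z _ rfl (hz _) ≫ K.homologyπ n ≫
      HomologicalComplex.homologyMap γ n ≫ L.homologyι n ≫ L.descOpcycles φ _ rfl (hφ _) := by
    intro γ
    simp
  rw [key, key, h]

/-- The coefficient module `ℤ/2ℤ`. -/
abbrev coeffModule : ModuleCat.{0} (ZMod 2) := ModuleCat.of (ZMod 2) (ZMod 2)

/-- The `n`-cochain of a simplicial set with a given value on each `n`-simplex. -/
def cochain (X : SSet.{0}) (n : ℕ) (χ : X _⦋n⦌ → ZMod 2) :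
    (X.chainComplex coeffModule).X n ⟶ coeffModule :=
  Sigma.desc (fun x => ModuleCat.ofHom (χ x • LinearMap.id))

lemma ι_cochain (X : SSet.{0}) (n : ℕ) (χ : X _⦋n⦌ → ZMod 2) (x : X _⦋n⦌) :
    X.ιChainComplex x ≫ cochain X n χ = ModuleCat.ofHom (χ x • LinearMap.id) :=
  Sigma.ι_desc (fun x => ModuleCat.ofHom (χ x • LinearMap.id)) x

lemma ι_cochain_inj {X Y : SSet.{0}} {n : ℕ} {χ : X _⦋n⦌ → ZMod 2} {x : X _⦋n⦌}
    {ψ : Y _⦋n⦌ → ZMod 2} {y : Y _⦋n⦌}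
    (h : X.ιChainComplex x ≫ cochain X n χ = Y.ιChainComplex y ≫ cochain Y n ψ) : χ x = ψ y := by
  rw [ι_cochain, ι_cochain] at h
  simpa using congrArg (fun f => f.hom (1 : ZMod 2)) h

/-- A cochain that sums to zero over the faces of each simplex is a cocycle. -/
lemma d_comp_cochain (X : SSet.{0}) (n : ℕ) (χ : X _⦋n⦌ → ZMod 2)
    (h : ∀ x : X _⦋n+1⦌, ∑ i, χ (X.δ i x) = 0) (m : ℕ) :
    (X.chainComplex coeffModule).d m n ≫ cochain X n χ = 0 := by
  by_cases hn : m = n + 1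
  · subst hn
    apply SSet.chainComplex_hom_ext
    intro x
    rw [SSet.ιChainComplex_d_assoc, Preadditive.sum_comp]
    have : ∀ i : Fin (n+2), ((-1) ^ i.val • X.ιChainComplex (X.δ i x)) ≫ cochain X n χ =
        ModuleCat.ofHom (χ (X.δ i x) • LinearMap.id) := by
      intro i
      rw [Preadditive.zsmul_comp, ι_cochain]
      ext
      rcases neg_one_pow_eq_or ℤ i.val with h | h <;> simp [h, ZMod.neg_eq_self_mod_two]
    rw [Finset.sum_congr rfl fun i _ => this i, comp_zero, ← ModuleCat.hom_injective.eq_iff]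
    ext
    simp [← h x]
  · rw [HomologicalComplex.shape _ _ _ (by simp; omega), zero_comp]

/-- The map induced by a continuous map in `H_p(-; ℤ/2ℤ)`. -/
abbrev homologyMap (p : ℕ) {X Y : Type} [TopologicalSpace X] [TopologicalSpace Y] (f : C(X, Y)) :
    ((singularHomologyFunctor (ModuleCat.{0} (ZMod 2)) p).obj coeffModule).obj (TopCat.of X) ⟶
      ((singularHomologyFunctor (ModuleCat.{0} (ZMod 2)) p).obj coeffModule).obj (TopCat.of Y) :=
  ((singularHomologyFunctor (ModuleCat.{0} (ZMod 2)) p).obj coeffModule).map (TopCat.ofHom f)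

section
variable {X Y Z : Type} [TopologicalSpace X] [TopologicalSpace Y] [TopologicalSpace Z]

lemma homologyMap_comp (p : ℕ) (g : C(Y, Z)) (f : C(X, Y)) :
    homologyMap p (g.comp f) = homologyMap p f ≫ homologyMap p g :=
  (((singularHomologyFunctor (ModuleCat.{0} (ZMod 2)) p).obj coeffModule).map_comp
    (TopCat.ofHom f) (TopCat.ofHom g))

lemma homologyMap_eq_of_homotopic (p : ℕ) {f g : C(X, Y)} (h : f.Homotopic g) :
    homologyMap p f = homologyMap p g := by
  obtain ⟨H⟩ := h
  have H' : TopCat.Homotopy (TopCat.ofHom f) (TopCat.ofHom g) := H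
  exact H'.congr_homologyMap_singularChainComplexFunctor coeffModule p

lemma homologyMap_one_const (y : Y) : homologyMap 1 (ContinuousMap.const X y) = 0 := by
  have : ContinuousMap.const X y =
    (ContinuousMap.const Unit y).comp (ContinuousMap.const X ()) := rfl
  rw [this, homologyMap_comp]
  rw [(isZero_singularHomologyFunctor_of_totallyDisconnectedSpace _ 1 coeffModule
    (TopCat.of Unit) one_ne_zero).eq_zero_of_tgt (homologyMap 1 (ContinuousMap.const X ())),
    zero_comp]

lemma homologyMap_one_of_nullhomotopic {f : C(X, Y)} (h : f.Nullhomotopic) :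
    homologyMap 1 f = 0 := by
  obtain ⟨y, hy⟩ := h
  rw [homologyMap_eq_of_homotopic 1 hy, homologyMap_one_const]

end

/-- A singular simplex as a continuous map. -/
def simplexMap {X : TopCat.{0}} {n : ℕ} (x : (TopCat.toSSet.obj X) _⦋n⦌) :
    C(SimplexCategory.toTop.{0}.obj ⦋n⦌, X) :=
  TopCat.Hom.hom (X := SimplexCategory.toTop.{0}.obj ⦋n⦌) (Y := X) x.down

/-- The singular simplex given by a continuous map. -/
def simplexOf {X : TopCat.{0}} {n : ℕ} (f : C(SimplexCategory.toTop.{0}.obj ⦋n⦌, X)) :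
    (TopCat.toSSet.obj X) _⦋n⦌ :=
  ⟨TopCat.ofHom f⟩

lemma simplexMap_δ {X : TopCat.{0}} {n : ℕ} (x : (TopCat.toSSet.obj X) _⦋n + 1⦌)
    (i : Fin (n + 2)) (p : SimplexCategory.toTop.{0}.obj ⦋n⦌) :
    simplexMap ((TopCat.toSSet.obj X).δ i x) p =
      simplexMap x (SimplexCategory.toTop.{0}.map (SimplexCategory.δ i) p) := rfl

lemma simplexMap_injective {X : TopCat.{0}} {n : ℕ} :
    Function.Injective (simplexMap (X := X) (n := n)) := by
  rintro ⟨x⟩ ⟨y⟩ h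
  exact congrArg ULift.up (TopCat.hom_ext h)

/-- If `H₀` of a subspace injects into `H₀` of a path connected space, then the subspace is
connected: a separation of it is a `0`-cocycle telling apart two points which are homologous in
the ambient space. -/
theorem isPreconnected_of_homologyInclusion_zero_injective {X : Type} [TopologicalSpace X]
    {A B : Set X} (hAB : A ⊆ B) (hB : IsPathConnected B)
    (h : Function.Injective (homologyInclusion hAB 0)) : IsPreconnected A := by
  rw [isPreconnected_iff_preconnectedSpace]
  have := isPathConnected_iff_pathConnectedSpace.mp hB
  rw [preconnectedSpace_iff_clopen]
  intro s hs
  by_contra! hcon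
  obtain ⟨hne, huniv⟩ := hcon
  obtain ⟨a, ha⟩ := hne
  obtain ⟨b, hb⟩ := (Set.ne_univ_iff_exists_notMem s).1 huniv
  classical
  let c (x : A) : C(Unit, A) := ContinuousMap.const Unit x
  have hab : homologyMap 0 (c a) = homologyMap 0 (c b) := by
    have hmono : Mono (homologyInclusion hAB 0) := (ModuleCat.mono_iff_injective _).2 h
    have key : ∀ x, homologyMap 0 (c x) ≫ homologyInclusion hAB 0 =
        homologyMap 0 (ContinuousMap.const Unit (Set.inclusion hAB x)) := fun x =>
      (homologyMap_comp 0 ⟨Set.inclusion hAB, continuous_inclusion hAB⟩ (c x)).symm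
    rw [← cancel_mono (homologyInclusion hAB 0), key, key]
    apply homologyMap_eq_of_homotopic
    obtain ⟨γ⟩ := PathConnectedSpace.joined (Set.inclusion hAB a) (Set.inclusion hAB b)
    exact ⟨{ toFun := fun p => γ p.1, map_zero_left := by simp, map_one_left := by simp }⟩
  let Y := TopCat.toSSet.obj (TopCat.of A)
  let pt (n : ℕ) : SimplexCategory.toTop.obj ⦋n⦌ := Classical.arbitrary _
  let χ : Y _⦋0⦌ → ZMod 2 := fun x => if simplexMap x (pt 0) ∈ s then 1 else 0
  let z : (TopCat.toSSet.obj (TopCat.of Unit)) _⦋0⦌ := simplexOf (ContinuousMap.const _ ())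
  have hχ : ∀ x : Y _⦋1⦌, ∑ i, χ (Y.δ i x) = 0 := by
    intro x
    have hconst : ∀ p q : SimplexCategory.toTop.obj ⦋1⦌,
        simplexMap x p ∈ s ↔ simplexMap x q ∈ s := by
      have hcl : IsClopen (simplexMap x ⁻¹' s) := hs.preimage (simplexMap x).continuous
      rcases isClopen_iff.1 hcl with h0 | h0
      · intro p q
        have h1 : p ∉ simplexMap x ⁻¹' s := by simp [h0]
        have h2 : q ∉ simplexMap x ⁻¹' s := by simp [h0]
        exact iff_of_false h1 h2
      · intro p q
        have h1 : p ∈ simplexMap x ⁻¹' s := by simp [h0]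
        have h2 : q ∈ simplexMap x ⁻¹' s := by simp [h0]
        exact iff_of_true h1 h2
    have h1 : ∀ i, χ (Y.δ i x) = if simplexMap x (pt 1) ∈ s then 1 else 0 := by
      intro i
      simp only [χ, Y]
      exact if_congr (hconst _ _) rfl rfl
    rw [Finset.sum_congr rfl fun i _ => h1 i]
    simp only [Finset.sum_const, Finset.card_univ, Fintype.card_fin]
    split_ifs <;> decide
  have key := cycle_comp_cocycle_eq_of_homologyMap_eq
    (α := SSet.chainComplexMap (TopCat.toSSet.map (TopCat.ofHom (c a))) coeffModule)
    (β := SSet.chainComplexMap (TopCat.toSSet.map (TopCat.ofHom (c b))) coeffModule) (n := 0)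
    hab (SSet.ιChainComplex _ z)
    (fun m => by rw [HomologicalComplex.shape _ _ _ (by simp), comp_zero])
    (cochain Y 0 χ) (d_comp_cochain Y 0 χ hχ)
  rw [SSet.ι_chainComplexMap_f_assoc, SSet.ι_chainComplexMap_f_assoc] at key
  have := ι_cochain_inj key
  have e1 : χ ((TopCat.toSSet.map (TopCat.ofHom (c a))).app _ z) = if a ∈ s then 1 else 0 := rfl
  have e2 : χ ((TopCat.toSSet.map (TopCat.ofHom (c b))).app _ z) = if b ∈ s then 1 else 0 := rfl
  rw [e1, e2, if_pos ha, if_neg hb] at this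
  exact one_ne_zero this

instance contractibleSpace_toTop (n : ℕ) : ContractibleSpace (SimplexCategory.toTop.{0}.obj ⦋n⦌) :=
  haveI : ContractibleSpace (stdSimplex ℝ (Fin (n + 1))) :=
    (convex_stdSimplex ℝ (Fin (n + 1))).contractibleSpace ⟨_, single_mem_stdSimplex ℝ 0⟩
  (Homeomorph.ulift (X := stdSimplex ℝ (Fin (n + 1)))).contractibleSpace

instance locallyPathConnectedSpace_toTop (n : ℕ) :
    LocallyPathConnectedSpace (SimplexCategory.toTop.{0}.obj ⦋n⦌) :=
  haveI : LocallyPathConnectedSpace (stdSimplex ℝ (Fin (n + 1))) :=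
    (convex_stdSimplex ℝ (Fin (n + 1))).locallyPathConnectedSpace
  (Homeomorph.ulift (X := stdSimplex ℝ (Fin (n + 1)))).isOpenEmbedding.locallyPathConnectedSpace

/-- The `i`-th vertex of the topological `n`-simplex. -/
def simplexVertex (n : ℕ) (i : Fin (n + 1)) : SimplexCategory.toTop.{0}.obj ⦋n⦌ :=
  ULift.up (stdSimplex.vertex (S := ℝ) i)

lemma toTop_map_δ_simplexVertex (n : ℕ) (i : Fin (n + 2)) (k : Fin (n + 1)) :
    SimplexCategory.toTop.{0}.map (SimplexCategory.δ i) (simplexVertex n k) =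
      simplexVertex (n + 1) (i.succAbove k) :=
  congrArg ULift.up (stdSimplex.map_vertex (S := ℝ) i.succAbove k)

lemma simplexMap_δ_simplexVertex {X : TopCat.{0}} {n : ℕ} (x : (TopCat.toSSet.obj X) _⦋n + 1⦌)
    (i : Fin (n + 2)) (k : Fin (n + 1)) :
    simplexMap ((TopCat.toSSet.obj X).δ i x) (simplexVertex n k) =
      simplexMap x (simplexVertex (n + 1) (i.succAbove k)) :=
  (simplexMap_δ x i _).trans (congrArg _ (toTop_map_δ_simplexVertex n i k))

lemma exists_angle_lift {n : ℕ} (f : C(SimplexCategory.toTop.{0}.obj ⦋n⦌, Circle)) :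
    ∃ F : C(SimplexCategory.toTop.{0}.obj ⦋n⦌, ℝ), ∀ p, Circle.exp (F p) = f p := by
  obtain ⟨t, ht⟩ : ∃ t, Circle.exp t = f (simplexVertex n 0) := ⟨_, Circle.exp_arg _⟩
  obtain ⟨F, ⟨-, hF⟩, -⟩ := Circle.isCoveringMap_exp.existsUnique_continuousMap_lifts f _ t ht
  exact ⟨F, fun p => congrFun hF p⟩

lemma angle_lift_unique {n : ℕ} {F G : C(SimplexCategory.toTop.{0}.obj ⦋n⦌, ℝ)}
    (h : ∀ p, Circle.exp (F p) = Circle.exp (G p)) :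
    ∃ m : ℤ, ∀ p, F p = G p + m * (2 * Real.pi) := by
  obtain ⟨m, hm⟩ := Circle.exp_eq_exp.1 (h (simplexVertex n 0))
  refine ⟨m, ?_⟩
  let f : C(SimplexCategory.toTop.{0}.obj ⦋n⦌, Circle) := ⟨fun p => Circle.exp (F p), by fun_prop⟩
  obtain ⟨F', -, hu⟩ := Circle.isCoveringMap_exp.existsUnique_continuousMap_lifts f
    (simplexVertex n 0) (F (simplexVertex n 0)) rfl
  let G' : C(SimplexCategory.toTop.{0}.obj ⦋n⦌, ℝ) :=
    ⟨fun p => G p + m * (2 * Real.pi), by fun_prop⟩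
  have h1 : F = F' := hu F ⟨rfl, rfl⟩
  have h2 : G' = F' := by
    refine hu G' ⟨hm.symm, funext fun p => ?_⟩
    have : Circle.exp (G p + m * (2 * Real.pi)) = Circle.exp (G p) :=
      Circle.exp_eq_exp.2 ⟨m, rfl⟩
    exact this.trans (h p).symm
  intro p
  exact DFunLike.congr_fun (h1.trans h2.symm) p

/-- The number of full turns completed by an angle. -/
def turns (t : ℝ) : ℤ := ⌊t / (2 * Real.pi)⌋

lemma turns_add (t : ℝ) (m : ℤ) : turns (t + m * (2 * Real.pi)) = turns t + m := by
  have := Real.pi_pos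
  rw [turns, add_div, mul_div_cancel_right₀ _ (by positivity), Int.floor_add_intCast, turns]

/-- The `1`-cochain of the circle that generates its first cohomology: the number of full turns
by which the angle grows along a `1`-simplex, modulo `2`. -/
def angleCochain (x : (TopCat.toSSet.obj (TopCat.of Circle)) _⦋1⦌) : ZMod 2 :=
  ((turns ((exists_angle_lift (simplexMap x)).choose (simplexVertex 1 1)) -
    turns ((exists_angle_lift (simplexMap x)).choose (simplexVertex 1 0)) : ℤ) : ZMod 2)

lemma angleCochain_eq {x : (TopCat.toSSet.obj (TopCat.of Circle)) _⦋1⦌}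
    (F : C(SimplexCategory.toTop.{0}.obj ⦋1⦌, ℝ)) (hF : ∀ p, Circle.exp (F p) = simplexMap x p) :
    angleCochain x =
      ((turns (F (simplexVertex 1 1)) - turns (F (simplexVertex 1 0)) : ℤ) : ZMod 2) := by
  obtain ⟨m, hm⟩ := angle_lift_unique (F := (exists_angle_lift (simplexMap x)).choose) (G := F)
    fun p => ((exists_angle_lift (simplexMap x)).choose_spec p).trans (hF p).symm
  rw [angleCochain, hm, hm, turns_add, turns_add]
  congr 1
  ring

lemma sum_angleCochain_δ (x : (TopCat.toSSet.obj (TopCat.of Circle)) _⦋2⦌) :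
    ∑ i, angleCochain ((TopCat.toSSet.obj (TopCat.of Circle)).δ i x) = 0 := by
  obtain ⟨F, hF⟩ := exists_angle_lift (simplexMap x)
  have key : ∀ i : Fin 3, angleCochain ((TopCat.toSSet.obj (TopCat.of Circle)).δ i x) =
      ((turns (F (simplexVertex 2 (i.succAbove 1))) -
        turns (F (simplexVertex 2 (i.succAbove 0))) : ℤ) : ZMod 2) := by
    intro i
    rw [angleCochain_eq
      (F.comp (TopCat.Hom.hom (SimplexCategory.toTop.{0}.map (SimplexCategory.δ i))))
      (fun p => by rw [simplexMap_δ]; exact hF _)]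
    simp only [ContinuousMap.comp_apply]
    erw [toTop_map_δ_simplexVertex, toTop_map_δ_simplexVertex]
  refine (Fin.sum_univ_three _).trans ?_
  rw [key, key, key]
  have e : (0 : Fin 3).succAbove 1 = 2 ∧ (0 : Fin 3).succAbove 0 = 1 ∧ (1 : Fin 3).succAbove 1 = 2 ∧
    (1 : Fin 3).succAbove 0 = 0 ∧ (2 : Fin 3).succAbove 1 = 1 ∧ (2 : Fin 3).succAbove 0 = 0 := by
    decide
  obtain ⟨e1, e2, e3, e4, e5, e6⟩ := e
  rw [e1, e2, e3, e4, e5, e6, ← Int.cast_add, ← Int.cast_add]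
  exact (ZMod.intCast_zmod_eq_zero_iff_dvd _ 2).2
    ⟨turns (F (simplexVertex 2 2)) - turns (F (simplexVertex 2 0)), by push_cast; ring⟩

/-- The circle has non-trivial first homology. -/
theorem homologyMap_one_id_circle_ne_zero : homologyMap 1 (ContinuousMap.id Circle) ≠ 0 := by
  intro h
  let Y := TopCat.toSSet.obj (TopCat.of Circle)
  let F : C(SimplexCategory.toTop.{0}.obj ⦋1⦌, ℝ) :=
    ⟨fun p => 2 * Real.pi * (ULift.down p : stdSimplex ℝ (Fin 2)).1 1, by
      have h1 : Continuous (ULift.down : ULift (stdSimplex ℝ (Fin 2)) → _) := continuous_uliftDown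
      have h2 : Continuous fun p : ULift (stdSimplex ℝ (Fin 2)) => (p.down).1 1 :=
        (continuous_apply 1).comp (continuous_subtype_val.comp h1)
      exact continuous_const.mul h2⟩
  have hF1 : F (simplexVertex 1 1) = 2 * Real.pi := by
    simp [F, simplexVertex]
  have hF0 : F (simplexVertex 1 0) = 0 := by
    simp [F, simplexVertex]
  let x : Y _⦋1⦌ := simplexOf ⟨fun p => Circle.exp (F p), by fun_prop⟩
  have hx : angleCochain x = 1 := by
    rw [angleCochain_eq F fun p => rfl, hF1, hF0]
    have := Real.pi_pos
    simp [turns, Real.pi_ne_zero]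
  have hδ : (TopCat.toSSet.obj (TopCat.of Circle)).δ 0 x =
      (TopCat.toSSet.obj (TopCat.of Circle)).δ 1 x := by
    refine simplexMap_injective (ContinuousMap.ext fun p => ?_)
    have hp : p = simplexVertex 0 0 := Subsingleton.elim _ _
    subst hp
    refine (simplexMap_δ_simplexVertex x 0 0).trans
      (Eq.trans ?_ (simplexMap_δ_simplexVertex x 1 0).symm)
    have e1 : simplexMap x (simplexVertex 1 1) = Circle.exp (F (simplexVertex 1 1)) := rfl
    have e2 : simplexMap x (simplexVertex 1 0) = Circle.exp (F (simplexVertex 1 0)) := rfl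
    have : simplexMap x (simplexVertex 1 1) = simplexMap x (simplexVertex 1 0) := by
      rw [e1, e2, hF1, hF0]; simp
    exact this
  have key := cycle_comp_cocycle_eq_of_homologyMap_eq (n := 1)
    (α := SSet.chainComplexMap (TopCat.toSSet.map (TopCat.ofHom (ContinuousMap.id Circle)))
      coeffModule) (β := 0)
    (by rw [HomologicalComplex.homologyMap_zero]; exact h) (SSet.ιChainComplex _ x)
    (fun m => by
      by_cases hm : m = 0
      · subst hm
        rw [SSet.ιChainComplex_d]
        refine (Fin.sum_univ_two _).trans ?_
        have := congrArg (SSet.ιChainComplex (R := coeffModule) _) hδ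
        simp [this]
      · rw [HomologicalComplex.shape _ _ _ (by simp; omega), comp_zero])
    (cochain Y 1 angleCochain) (d_comp_cochain Y 1 _ sum_angleCochain_δ)
  rw [SSet.ι_chainComplexMap_f_assoc, HomologicalComplex.zero_f, zero_comp, comp_zero,
    ι_cochain] at key
  have h1 := congrArg (fun f => f.hom (1 : ZMod 2)) key
  have h2 : angleCochain x * 1 = 0 := h1
  rw [hx] at h2
  exact one_ne_zero h2

end Homology

/-! ### Faces of convex sets -/

section Convex

variable {E : Type*} [NormedAddCommGroup E] [NormedSpace ℝ E]

/-- The direction `u` is feasible at the point `x` of `P`: one can move a little from `x` in the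
direction `u` without leaving the (convex) set `P`. -/
def IsFeasible (P : Set E) (x u : E) : Prop := ∃ ε : ℝ, 0 < ε ∧ x + ε • u ∈ P

/-- The direction space of the smallest face of the convex set `P` that contains `x`: it consists
of the vectors `u` such that both `u` and `-u` are feasible at `x`. -/
def faceDir (P : Set E) (x : E) : Submodule ℝ E :=
  Submodule.span ℝ {u | IsFeasible P x u ∧ IsFeasible P x (-u)}

/-- The `k`-skeleton of a convex set: the points that lie in a face of dimension at most `k`. -/
def skeleton (k : ℕ) (P : Set E) : Set E :=
  {x | x ∈ P ∧ Module.finrank ℝ (faceDir P x) ≤ k}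

variable {P : Set E} {x u u' v w y : E}

lemma convex_setOf_sub_mem (L : Submodule ℝ E) (x : E) : Convex ℝ {y | y - x ∈ L} := by
  intro a ha b hb s t hs ht hst
  have : s • a + t • b - x = s • (a - x) + t • (b - x) := by
    obtain rfl : s = 1 - t := by linarith
    module
  simp only [Set.mem_ofPred_eq] at ha hb ⊢
  rw [this]
  exact add_mem (Submodule.smul_mem _ _ ha) (Submodule.smul_mem _ _ hb)

lemma isFeasible_sub (hy : y ∈ P) : IsFeasible P x (y - x) :=
  ⟨1, one_pos, by simpa using hy⟩

lemma IsFeasible.forall_small (hP : Convex ℝ P) (hx : x ∈ P) (h : IsFeasible P x u) :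
    ∃ ε : ℝ, 0 < ε ∧ ∀ t, 0 ≤ t → t ≤ ε → x + t • u ∈ P := by
  obtain ⟨ε, hε, hu⟩ := h
  refine ⟨ε, hε, fun t ht hte => ?_⟩
  have := hP.add_smul_mem hx hu (t := t / ε) ⟨by positivity, (div_le_one hε).2 hte⟩
  rwa [smul_smul, div_mul_cancel₀ _ hε.ne'] at this

lemma IsFeasible.add (hP : Convex ℝ P) (hx : x ∈ P) (h : IsFeasible P x u)
    (h' : IsFeasible P x u') : IsFeasible P x (u + u') := by
  obtain ⟨ε, hε, hu⟩ := h.forall_small hP hx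
  obtain ⟨ε', hε', hu'⟩ := h'.forall_small hP hx
  have hm : 0 < min ε ε' := lt_min hε hε'
  refine ⟨min ε ε' / 2, by positivity, ?_⟩
  have := hP (hu _ hm.le (min_le_left _ _)) (hu' _ hm.le (min_le_right _ _))
    (a := 1 / 2) (b := 1 / 2) (by norm_num) (by norm_num) (by norm_num)
  convert! this using 1
  module

lemma IsFeasible.smul (hx : x ∈ P) (h : IsFeasible P x u) {c : ℝ} (hc : 0 ≤ c) :
    IsFeasible P x (c • u) := by
  rcases hc.eq_or_lt with rfl | hc
  · exact ⟨1, one_pos, by simpa using hx⟩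
  · obtain ⟨ε, hε, hu⟩ := h
    refine ⟨ε / c, by positivity, ?_⟩
    rwa [smul_smul, div_mul_cancel₀ _ hc.ne']

lemma mem_faceDir (hP : Convex ℝ P) (hx : x ∈ P) :
    u ∈ faceDir P x ↔ IsFeasible P x u ∧ IsFeasible P x (-u) := by
  refine ⟨fun h => ?_, fun h => Submodule.subset_span h⟩
  induction h using Submodule.span_induction with
  | mem u h => exact h
  | zero =>
    have : IsFeasible P x 0 := ⟨1, one_pos, by simpa using hx⟩
    simpa using this
  | add u u' _ _ h h' =>
    refine ⟨h.1.add hP hx h'.1, ?_⟩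
    rw [neg_add]
    exact h.2.add hP hx h'.2
  | smul c u _ h =>
    rcases le_total 0 c with hc | hc
    · refine ⟨h.1.smul hx hc, ?_⟩
      rw [← smul_neg]
      exact h.2.smul hx hc
    · constructor
      · have := h.2.smul hx (neg_nonneg.2 hc)
        rwa [smul_neg, neg_smul, neg_neg] at this
      · have := h.1.smul hx (neg_nonneg.2 hc)
        rwa [neg_smul] at this

/-- A point of `P` is in the direction of the face of `x` as soon as `P` extends beyond `x`, seen
from that point. -/
lemma sub_mem_faceDir (hP : Convex ℝ P) (hx : x ∈ P) (hy : y ∈ P) (h : IsFeasible P x (x - y)) :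
    y - x ∈ faceDir P x :=
  (mem_faceDir hP hx).2 ⟨isFeasible_sub hy, by rwa [neg_sub]⟩

/-- A direction that is feasible at some point of the smallest face of `x` is feasible at `x`. -/
lemma IsFeasible.of_sub_mem_faceDir (hP : Convex ℝ P) (hx : x ∈ P) (hyx : y - x ∈ faceDir P x)
    (h : IsFeasible P y u) : IsFeasible P x u := by
  obtain ⟨ε, hε, hmem⟩ := h
  have hxy := ((mem_faceDir hP hx).1 hyx).2
  have h1 := (isFeasible_sub (x := x) hmem).add hP hx hxy
  convert! h1.smul hx (inv_nonneg.2 hε.le) using 1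
  match_scalars <;> field_simp <;> ring

lemma faceDir_le_of_mem_openSegment (hP : Convex ℝ P) (hv : v ∈ P) (hw : w ∈ P)
    (hx : x ∈ openSegment ℝ v w) : faceDir P w ≤ faceDir P x := by
  have hxP : x ∈ P := hP.openSegment_subset hv hw hx
  obtain ⟨a, b, ha, hb, hab, rfl⟩ := hx
  have key : ∀ u, IsFeasible P w u → IsFeasible P (a • v + b • w) u := by
    rintro u ⟨ε, hε, hu⟩
    refine ⟨b * ε, by positivity, ?_⟩
    convert! hP hv hu ha.le hb.le hab using 1
    module
  intro u hu
  rw [mem_faceDir hP hw] at hu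
  exact (mem_faceDir hP hxP).2 ⟨key _ hu.1, key _ hu.2⟩

lemma sub_mem_faceDir_of_mem_openSegment (hP : Convex ℝ P) (hv : v ∈ P) (hw : w ∈ P)
    (hx : x ∈ openSegment ℝ v w) : x - v ∈ faceDir P x := by
  have hxP : x ∈ P := hP.openSegment_subset hv hw hx
  have := (faceDir P x).neg_mem (sub_mem_faceDir hP hxP hv ?_)
  · rwa [neg_sub] at this
  · obtain ⟨a, b, ha, hb, hab, rfl⟩ := hx
    refine ⟨a / b, by positivity, ?_⟩
    convert! hw using 1
    obtain rfl : a = 1 - b := by linarith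
    match_scalars <;> field_simp <;> ring

/-- All points of an open segment in `P` lie in the relative interior of the same face. -/
lemma faceDir_le_of_mem_openSegment_of_mem_openSegment (hP : Convex ℝ P) (hv : v ∈ P) (hw : w ∈ P)
    (hx : x ∈ openSegment ℝ v w) (hy : y ∈ openSegment ℝ v w) : faceDir P x ≤ faceDir P y := by
  have hxP : x ∈ P := hP.openSegment_subset hv hw hx
  obtain ⟨a, b, ha, hb, hab, rfl⟩ := hx
  obtain ⟨c, d, hc, hd, hcd, rfl⟩ := hy
  rcases lt_trichotomy b d with h | rfl | h
  · refine faceDir_le_of_mem_openSegment hP hw hxP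
      ⟨(d - b) / a, c / a, div_pos (by linarith) ha, by positivity, ?_, ?_⟩
    · field_simp; linarith
    · obtain rfl : a = 1 - b := by linarith
      obtain rfl : c = 1 - d := by linarith
      match_scalars <;> field_simp <;> ring
  · obtain rfl : a = c := by linarith
    exact le_rfl
  · refine faceDir_le_of_mem_openSegment hP hv hxP
      ⟨1 - d / b, d / b, ?_, by positivity, by ring, ?_⟩
    · rw [sub_pos, div_lt_one hb]; exact h
    · obtain rfl : a = 1 - b := by linarith
      obtain rfl : c = 1 - d := by linarith
      match_scalars <;> field_simp <;> ring

lemma faceDir_eq_bot_of_mem_extremePoints (hP : Convex ℝ P) (hx : x ∈ P.extremePoints ℝ) :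
    faceDir P x = ⊥ := by
  rw [eq_bot_iff]
  intro u hu
  obtain ⟨h1, h2⟩ := (mem_faceDir hP hx.1).1 hu
  obtain ⟨ε, hε, h1⟩ := h1.forall_small hP hx.1
  obtain ⟨ε', hε', h2⟩ := h2.forall_small hP hx.1
  have hm : 0 < min ε ε' := lt_min hε hε'
  have := (mem_extremePoints.1 hx).2 _ (h1 _ hm.le (min_le_left _ _)) _
    (h2 _ hm.le (min_le_right _ _)) ⟨1 / 2, 1 / 2, by norm_num, by norm_num, by norm_num, by module⟩
  have := this.1
  rw [add_eq_left, smul_eq_zero] at this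
  simpa using this.resolve_left hm.ne'

/-- A point of a polytope is in the convex hull of the vertices of its smallest face. -/
lemma mem_convexHull_face {V : Finset E} (hx : x ∈ convexHull ℝ (V : Set E)) :
    x ∈ convexHull ℝ {w | w ∈ V ∧ w - x ∈ faceDir (convexHull ℝ (V : Set E)) x} := by
  have hP := convex_convexHull ℝ (V : Set E)
  obtain ⟨c, hc0, hc1, hcx⟩ := Finset.mem_convexHull'.1 hx
  have hpos : ∀ i ∈ V, 0 < c i → i - x ∈ faceDir (convexHull ℝ (V : Set E)) x := by
    classical
    intro i hi hci
    refine sub_mem_faceDir hP hx (subset_convexHull ℝ _ hi) ⟨c i, hci, ?_⟩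
    rw [Finset.mem_convexHull']
    refine ⟨fun j => (1 + c i) * c j - if j = i then c i else 0, fun j hj => ?_, ?_, ?_⟩
    · have := hc0 j hj
      dsimp only
      split_ifs with h
      · subst h; nlinarith
      · simp only [sub_zero]; positivity
    · rw [Finset.sum_sub_distrib, ← Finset.mul_sum, hc1, Finset.sum_ite_eq' V i, if_pos hi]
      ring
    · simp only [sub_smul, mul_smul, ite_smul, zero_smul]
      rw [Finset.sum_sub_distrib, ← Finset.smul_sum, hcx, Finset.sum_ite_eq' V i, if_pos hi]
      module
  have hsum : ∑ i ∈ V with 0 < c i, c i • i = x := by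
    refine Eq.trans (Finset.sum_filter_of_ne fun i hi hne => (hc0 i hi).lt_of_ne' ?_) hcx
    rintro h
    simp [h] at hne
  have hmem := (convex_convexHull ℝ
    {w | w ∈ V ∧ w - x ∈ faceDir (convexHull ℝ (V : Set E)) x}).sum_mem
    (t := V.filter fun i => 0 < c i) (w := c) (z := id)
    (fun i hi => hc0 i (Finset.mem_filter.1 hi).1) ?_ ?_
  · simpa only [id, hsum] using hmem
  · rw [← hc1]
    exact Finset.sum_filter_of_ne fun i hi hne => (hc0 i hi).lt_of_ne' hne
  · intro i hi
    obtain ⟨hi, hci⟩ := Finset.mem_filter.1 hi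
    exact subset_convexHull ℝ _ ⟨hi, hpos i hi hci⟩

end Convex

/-! ### The vertex figure of a polytope -/

section VertexFigure

variable {E : Type*} [NormedAddCommGroup E] [NormedSpace ℝ E]

/-- The central projection from `v` onto the hyperplane `h (x - v) = 1`. -/
def centralProj (v : E) (h : E →L[ℝ] ℝ) (x : E) : E := v + (h (x - v))⁻¹ • (x - v)

open Classical in
/-- The vertices of the vertex figure at `v` of the polytope spanned by `V`, in the hyperplane
`h (x - v) = 1`. -/
def vertexFigure (V : Finset E) (v : E) (h : E →L[ℝ] ℝ) : Finset E :=
  (V.erase v).image (centralProj v h)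

/-- The part of the convex set `P` that is far from its point `v`: the last points in `P` of the
rays that start from `v`. -/
def farSide (P : Set E) (v : E) : Set E := {w | w ∈ P ∧ w ≠ v ∧ ¬ IsFeasible P w (w - v)}

variable {V : Finset E} {v w q x : E} {h : E →L[ℝ] ℝ}

lemma height_of_mem_vertexFigure (hh : ∀ w ∈ V, w ≠ v → 1 < h (w - v))
    (hq : q ∈ convexHull ℝ (vertexFigure V v h : Set E)) : h (q - v) = 1 := by
  classical
  have hconv : Convex ℝ {q | h (q - v) = 1} := by
    intro a ha b hb s t hs ht hst
    have : s • a + t • b - v = s • (a - v) + t • (b - v) := by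
      obtain rfl : s = 1 - t := by linarith
      module
    simp only [Set.mem_ofPred_eq] at ha hb ⊢
    rw [this, map_add, map_smul, map_smul, ha, hb]
    simpa using hst
  refine convexHull_min ?_ hconv hq
  intro q hq
  obtain ⟨w, hw, rfl⟩ := Finset.mem_image.1 (Finset.mem_coe.1 hq)
  have := hh w (Finset.mem_of_mem_erase hw) (Finset.ne_of_mem_erase hw)
  simp only [centralProj, Set.mem_ofPred_eq, add_sub_cancel_left, map_smul, smul_eq_mul]
  exact inv_mul_cancel₀ (by linarith)

lemma vertexFigure_subset (hv : v ∈ V) (hh : ∀ w ∈ V, w ≠ v → 1 < h (w - v)) :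
    convexHull ℝ (vertexFigure V v h : Set E) ⊆ convexHull ℝ (V : Set E) := by
  classical
  refine convexHull_min ?_ (convex_convexHull ℝ _)
  intro q hq
  obtain ⟨w, hw, rfl⟩ := Finset.mem_image.1 (Finset.mem_coe.1 hq)
  have h1 := hh w (Finset.mem_of_mem_erase hw) (Finset.ne_of_mem_erase hw)
  exact (convex_convexHull ℝ _).add_smul_sub_mem (subset_convexHull ℝ _ hv)
    (subset_convexHull ℝ _ (Finset.mem_of_mem_erase hw))
    ⟨by positivity, inv_le_one_of_one_le₀ h1.le⟩

/-- Every point of a polytope other than `v` lies on a ray from `v` through the vertex figure, and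
the last points of these rays lie beyond the hyperplane of the vertex figure. -/
lemma centralProj_mem_vertexFigure (hv : v ∈ V) (hh : ∀ w ∈ V, w ≠ v → 1 < h (w - v))
    (hx : x ∈ convexHull ℝ (V : Set E)) (hxv : x ≠ v) :
    0 < h (x - v) ∧ centralProj v h x ∈ convexHull ℝ (vertexFigure V v h : Set E) ∧
      (¬ IsFeasible (convexHull ℝ (V : Set E)) x (x - v) → 1 < h (x - v)) := by
  classical
  set Q := convexHull ℝ (vertexFigure V v h : Set E) with hQ
  have hconv : Convex ℝ {z | 1 < h (z - v) ∧ centralProj v h z ∈ Q} := by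
    rintro a ⟨ha, ha'⟩ b ⟨hb, hb'⟩ s t hs ht hst
    have e : s • a + t • b - v = s • (a - v) + t • (b - v) := by
      obtain rfl : s = 1 - t := by linarith
      module
    have hγ : 1 < s * h (a - v) + t * h (b - v) := by
      rcases hs.eq_or_lt with rfl | hs
      · obtain rfl : t = 1 := by linarith
        linarith
      · nlinarith
    refine ⟨by rw [e]; simpa using hγ, ?_⟩
    have hγ0 : s * h (a - v) + t * h (b - v) ≠ 0 := by linarith
    have hQc : Convex ℝ Q := convex_convexHull ℝ _
    have := hQc ha' hb' (a := s * h (a - v) / (s * h (a - v) + t * h (b - v)))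
      (b := t * h (b - v) / (s * h (a - v) + t * h (b - v)))
      (div_nonneg (mul_nonneg hs (by linarith)) (by linarith))
      (div_nonneg (mul_nonneg ht (by linarith)) (by linarith)) (by field_simp)
    convert! this using 1
    have ha0 : h (a - v) ≠ 0 := by linarith
    have hb0 : h (b - v) ≠ 0 := by linarith
    simp only [centralProj]
    rw [e, map_add, map_smul, map_smul, smul_eq_mul, smul_eq_mul]
    generalize h (a - v) = α at *
    generalize h (b - v) = β at *
    match_scalars <;> field_simp <;> ring
  have hmem : convexHull ℝ ((V.erase v : Finset E) : Set E) ⊆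
      {z | 1 < h (z - v) ∧ centralProj v h z ∈ Q} := by
    refine convexHull_min (fun w hw => ?_) hconv
    exact ⟨hh w (Finset.mem_of_mem_erase hw) (Finset.ne_of_mem_erase hw),
      subset_convexHull ℝ _ (Finset.mem_coe.2 (Finset.mem_image_of_mem _ hw))⟩
  have hins : (V : Set E) = insert v ((V.erase v : Finset E) : Set E) := by
    rw [← Finset.coe_insert, Finset.insert_erase hv]
  have hne : ((V.erase v : Finset E) : Set E).Nonempty := by
    by_contra! hemp
    rw [hins, hemp] at hx
    simp at hx
    exact hxv hx
  have hx' := hx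
  rw [hins, convexHull_insert hne, mem_convexJoin] at hx'
  obtain ⟨v', rfl, z, hz, hxz⟩ := hx'
  obtain ⟨hz1, hz2⟩ := hmem hz
  rw [segment_eq_image'] at hxz
  obtain ⟨t, ⟨ht0, ht1⟩, rfl⟩ := hxz
  have ht : 0 < t := by
    refine ht0.lt_of_ne ?_
    rintro rfl
    simp at hxv
  simp only [add_sub_cancel_left, map_smul, smul_eq_mul]
  refine ⟨by positivity, ?_, ?_⟩
  · convert! hz2 using 1
    simp only [centralProj, add_sub_cancel_left, map_smul, smul_eq_mul, smul_smul]
    congr 2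
    have : h (z - v') ≠ 0 := by linarith
    field_simp
  · intro hnf
    have : t = 1 := by
      by_contra hne1
      have ht1' : t < 1 := ht1.lt_of_ne hne1
      refine hnf ⟨1 / t - 1, by rw [sub_pos, lt_div_iff₀ ht]; linarith, ?_⟩
      have hzP : z ∈ convexHull ℝ (V : Set E) := by
        refine convexHull_mono ?_ hz
        exact Finset.coe_subset.2 (Finset.erase_subset _ _)
      convert! hzP using 1
      match_scalars <;> field_simp <;> ring
    rw [this, one_mul]
    exact hz1

lemma one_lt_of_mem_farSide (hv : v ∈ V) (hh : ∀ w ∈ V, w ≠ v → 1 < h (w - v))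
    (hw : w ∈ farSide (convexHull ℝ (V : Set E)) v) : 1 < h (w - v) :=
  (centralProj_mem_vertexFigure hv hh hw.1 hw.2.1).2.2 hw.2.2

lemma exists_mem_farSide (hv : v ∈ V) (hh : ∀ w ∈ V, w ≠ v → 1 < h (w - v))
    (hq : q ∈ convexHull ℝ (vertexFigure V v h : Set E)) :
    ∃ w ∈ farSide (convexHull ℝ (V : Set E)) v, centralProj v h w = q := by
  set P := convexHull ℝ (V : Set E) with hP
  have hPc : IsCompact P := V.finite_toSet.isCompact_convexHull (𝕜 := ℝ)
  have hq1 := height_of_mem_vertexFigure hh hq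
  have hqP : q ∈ P := vertexFigure_subset hv hh hq
  let T : Set ℝ := {t | 1 ≤ t ∧ v + t • (q - v) ∈ P}
  have hclosed : IsClosed T :=
    isClosed_Ici.inter
      (hPc.isClosed.preimage (by fun_prop : Continuous fun t : ℝ => v + t • (q - v)))
  obtain ⟨C, hC⟩ := (hPc.image (f := fun x => h (x - v)) (by fun_prop)).bddAbove
  have hT : IsCompact T := by
    refine isCompact_Icc.of_isClosed_subset hclosed (s := Set.Icc 1 C) ?_
    rintro t ⟨ht1, ht⟩
    refine ⟨ht1, ?_⟩
    have := hC ⟨_, ht, rfl⟩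
    simpa [hq1] using this
  obtain ⟨t, ⟨ht1, htP⟩, htmax⟩ := hT.exists_isGreatest ⟨1, le_rfl, by simpa using hqP⟩
  refine ⟨v + t • (q - v), ⟨htP, ?_, ?_⟩, ?_⟩
  · intro heq
    rw [add_eq_left] at heq
    have := congrArg h heq
    rw [map_smul, hq1] at this
    simp at this
    linarith
  · rintro ⟨ε, hε, hmem⟩
    have : (1 + ε) * t ∈ T := by
      refine ⟨by nlinarith, ?_⟩
      convert! hmem using 1
      module
    have := htmax this
    nlinarith
  · simp only [centralProj, add_sub_cancel_left, map_smul, hq1, smul_eq_mul, mul_one, smul_smul]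
    rw [inv_mul_cancel₀ (by linarith)]
    simp

lemma centralProj_injOn_farSide (hv : v ∈ V) (hh : ∀ w ∈ V, w ≠ v → 1 < h (w - v)) :
    Set.InjOn (centralProj v h) (farSide (convexHull ℝ (V : Set E)) v) := by
  have key : ∀ w ∈ farSide (convexHull ℝ (V : Set E)) v,
      ∀ w' ∈ farSide (convexHull ℝ (V : Set E)) v, centralProj v h w = centralProj v h w' →
      h (w - v) ≤ h (w' - v) := by
    intro w hw w' hw' heq
    by_contra! hlt
    have h1 := one_lt_of_mem_farSide hv hh hw
    have h1' := one_lt_of_mem_farSide hv hh hw'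
    have h2 : w - v = (h (w - v) / h (w' - v)) • (w' - v) := by
      simp only [centralProj, add_right_inj] at heq
      rw [div_eq_mul_inv, mul_smul, ← heq, smul_smul, mul_inv_cancel₀ (by linarith), one_smul]
    refine hw'.2.2 ⟨h (w - v) / h (w' - v) - 1, ?_, ?_⟩
    · rw [sub_pos, lt_div_iff₀ (by linarith)]
      linarith
    · convert! hw.1 using 1
      rw [sub_smul, ← h2]
      module
  intro w hw w' hw' heq
  have e := le_antisymm (key w hw w' hw' heq) (key w' hw' w hw heq.symm)
  have h1 := one_lt_of_mem_farSide hv hh hw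
  simp only [centralProj, ← e, add_right_inj] at heq
  have := smul_right_injective E (inv_ne_zero (by linarith : h (w - v) ≠ 0)) heq
  simpa using this

/-- The far side is a union of finitely many polytopes: with a point it contains the smallest face
of that point. -/
lemma isCompact_farSide : IsCompact (farSide (convexHull ℝ (V : Set E)) v) := by
  classical
  set P := convexHull ℝ (V : Set E) with hPdef
  have hP : Convex ℝ P := convex_convexHull ℝ _
  have heq : farSide P v =
      ⋃ W ∈ V.powerset.filter (fun W : Finset E => convexHull ℝ (W : Set E) ⊆ farSide P v),
        convexHull ℝ (W : Set E) := by
    apply Set.Subset.antisymm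
    · intro x hx
      have hxF := mem_convexHull_face hx.1
      rw [Set.mem_iUnion₂]
      refine ⟨V.filter fun w => w - x ∈ faceDir P x, ?_, ?_⟩
      · refine Finset.mem_filter.2 ⟨Finset.mem_powerset.2 (Finset.filter_subset _ _), ?_⟩
        intro y hy
        have hyP : y ∈ P := convexHull_mono (Finset.coe_subset.2 (Finset.filter_subset _ _)) hy
        have hyx : y - x ∈ faceDir P x := by
          have hconv := convex_setOf_sub_mem (faceDir P x) x
          refine convexHull_min (fun w hw => ?_) hconv hy
          exact (Finset.mem_filter.1 (Finset.mem_coe.1 hw)).2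
        have hfeas : IsFeasible P x (x - y) := by
          have := ((mem_faceDir hP hx.1).1 hyx).2
          rwa [neg_sub] at this
        refine ⟨hyP, ?_, ?_⟩
        · rintro rfl
          exact hx.2.2 hfeas
        · intro hy'
          apply hx.2.2
          convert! (hy'.of_sub_mem_faceDir hP hx.1 hyx).add hP hx.1 hfeas using 1
          abel
      · convert! hxF using 2
        ext w
        simp [hPdef]
    · intro x hx
      rw [Set.mem_iUnion₂] at hx
      obtain ⟨W, hW, hxW⟩ := hx
      exact (Finset.mem_filter.1 hW).2 hxW
  rw [heq]
  exact Finset.isCompact_biUnion _ fun W _ => W.finite_toSet.isCompact_convexHull (𝕜 := ℝ)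

/-- The radial homeomorphism from the vertex figure to the far side of the polytope. -/
lemma exists_homeomorph_farSide (hv : v ∈ V) (hh : ∀ w ∈ V, w ≠ v → 1 < h (w - v)) :
    ∃ ρ : convexHull ℝ (vertexFigure V v h : Set E) ≃ₜ farSide (convexHull ℝ (V : Set E)) v,
      ∀ q, centralProj v h (ρ q : E) = q := by
  have : CompactSpace (farSide (convexHull ℝ (V : Set E)) v) :=
    isCompact_iff_compactSpace.1 isCompact_farSide
  let f : farSide (convexHull ℝ (V : Set E)) v → convexHull ℝ (vertexFigure V v h : Set E) :=
    fun w => ⟨centralProj v h w, (centralProj_mem_vertexFigure hv hh w.2.1 w.2.2.1).2.1⟩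
  have hf : Continuous f := by
    refine Continuous.subtype_mk ?_ _
    have h0 : ∀ w : farSide (convexHull ℝ (V : Set E)) v, h ((w : E) - v) ≠ 0 := fun w => by
      have := one_lt_of_mem_farSide hv hh w.2
      linarith
    have hc : Continuous fun w : farSide (convexHull ℝ (V : Set E)) v => h ((w : E) - v) := by
      fun_prop
    exact continuous_const.add ((hc.inv₀ h0).smul (by fun_prop))
  have hbij : Function.Bijective f := by
    constructor
    · intro w w' heq
      exact Subtype.ext (centralProj_injOn_farSide hv hh w.2 w'.2 (congrArg Subtype.val heq))
    · rintro ⟨q, hq⟩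
      obtain ⟨w, hw, hwq⟩ := exists_mem_farSide hv hh hq
      exact ⟨⟨w, hw⟩, Subtype.ext hwq⟩
  let e : farSide (convexHull ℝ (V : Set E)) v ≃ₜ convexHull ℝ (vertexFigure V v h : Set E) :=
    Continuous.homeoOfEquivCompactToT2 (f := Equiv.ofBijective f hbij) hf
  refine ⟨e.symm, fun q => ?_⟩
  have : f (e.symm q) = q := e.apply_symm_apply q
  exact congrArg Subtype.val this

lemma mem_openSegment_centralProj (hw : 1 < h (w - v)) :
    centralProj v h w ∈ openSegment ℝ v w := by
  refine ⟨1 - (h (w - v))⁻¹, (h (w - v))⁻¹, ?_, by positivity, by ring, ?_⟩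
  · rw [sub_pos]
    exact inv_lt_one_of_one_lt₀ hw
  · simp only [centralProj]
    module

variable [FiniteDimensional ℝ E]

/-- The smallest face of the end of a ray has smaller dimension than the face of the ray. -/
lemma finrank_faceDir_lt_of_mem_farSide (hv : v ∈ V) (hh : ∀ w ∈ V, w ≠ v → 1 < h (w - v))
    (hw : w ∈ farSide (convexHull ℝ (V : Set E)) v) :
    Module.finrank ℝ (faceDir (convexHull ℝ (V : Set E)) w) <
      Module.finrank ℝ (faceDir (convexHull ℝ (V : Set E)) (centralProj v h w)) := by
  have hP := convex_convexHull ℝ (V : Set E)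
  have hvP : v ∈ convexHull ℝ (V : Set E) := subset_convexHull ℝ _ hv
  have h1 := one_lt_of_mem_farSide hv hh hw
  have hseg := mem_openSegment_centralProj h1
  refine Submodule.finrank_lt_finrank_of_lt (lt_of_le_of_ne
    (faceDir_le_of_mem_openSegment hP hvP hw.1 hseg) fun heq => ?_)
  have hmem := sub_mem_faceDir_of_mem_openSegment hP hvP hw.1 hseg
  rw [← heq] at hmem
  have := (faceDir (convexHull ℝ (V : Set E)) w).smul_mem (h (w - v)) hmem
  rw [centralProj, add_sub_cancel_left, smul_smul, mul_inv_cancel₀ (by linarith), one_smul] at this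
  exact hw.2.2 ((mem_faceDir hP hw.1).1 this).1

/-- The smallest face of a point of the vertex figure is a hyperplane section of its smallest face
in the polytope. -/
lemma finrank_faceDir_le_vertexFigure (hv : v ∈ V) (hh : ∀ w ∈ V, w ≠ v → 1 < h (w - v))
    (hq : q ∈ convexHull ℝ (vertexFigure V v h : Set E))
    (hqv : q - v ∈ faceDir (convexHull ℝ (V : Set E)) q) :
    Module.finrank ℝ (faceDir (convexHull ℝ (V : Set E)) q) ≤
      Module.finrank ℝ (faceDir (convexHull ℝ (vertexFigure V v h : Set E)) q) + 1 := by
  have hP := convex_convexHull ℝ (V : Set E)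
  have hqP := vertexFigure_subset hv hh hq
  have hq1 := height_of_mem_vertexFigure hh hq
  have hfeas : ∀ u, h u = 0 → IsFeasible (convexHull ℝ (V : Set E)) q u →
      IsFeasible (convexHull ℝ (vertexFigure V v h : Set E)) q u := by
    rintro u hu ⟨ε, hε, hmem⟩
    refine ⟨ε, hε, ?_⟩
    have h1 : h (q + ε • u - v) = 1 := by
      rw [add_sub_right_comm, map_add, map_smul, hu, hq1]; simp
    have hne : q + ε • u ≠ v := by
      intro heq
      rw [heq] at h1
      simp at h1
    have := (centralProj_mem_vertexFigure hv hh hmem hne).2.1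
    rw [centralProj, h1] at this
    simpa using this
  have hle : faceDir (convexHull ℝ (V : Set E)) q ≤
      faceDir (convexHull ℝ (vertexFigure V v h : Set E)) q ⊔ Submodule.span ℝ {q - v} := by
    intro u hu
    have hu' : u - h u • (q - v) ∈ faceDir (convexHull ℝ (V : Set E)) q :=
      Submodule.sub_mem _ hu (Submodule.smul_mem _ _ hqv)
    have h0 : h (u - h u • (q - v)) = 0 := by
      rw [map_sub, map_smul, hq1]; simp
    have hmem := (mem_faceDir hP hqP).1 hu'
    have : u - h u • (q - v) ∈ faceDir (convexHull ℝ (vertexFigure V v h : Set E)) q :=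
      (mem_faceDir (convex_convexHull ℝ _) hq).2
        ⟨hfeas _ h0 hmem.1, hfeas _ (by rw [map_neg, h0, neg_zero]) hmem.2⟩
    rw [← sub_add_cancel u (h u • (q - v))]
    exact Submodule.add_mem_sup this
      (Submodule.smul_mem _ _ (Submodule.mem_span_singleton_self _))
  refine (Submodule.finrank_mono hle).trans
    ((Submodule.finrank_add_le_finrank_add_finrank _ _).trans ?_)
  gcongr
  exact (finrank_span_le_card _).trans (by simp)

/-- The affine dimension of the vertex figure is at most one less than that of the polytope. -/
lemma finrank_vectorSpan_le_vertexFigure (hv : v ∈ V) (hh : ∀ w ∈ V, w ≠ v → 1 < h (w - v))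
    (hq : q ∈ vertexFigure V v h) :
    Module.finrank ℝ (vectorSpan ℝ (V : Set E)) ≤
      Module.finrank ℝ (vectorSpan ℝ (vertexFigure V v h : Set E)) + 1 := by
  classical
  have hle : vectorSpan ℝ (V : Set E) ≤
      vectorSpan ℝ (vertexFigure V v h : Set E) ⊔ Submodule.span ℝ {q - v} := by
    rw [vectorSpan_eq_span_vsub_set_right ℝ (Finset.mem_coe.2 hv), Submodule.span_le]
    rintro _ ⟨w, hw, rfl⟩
    simp only [vsub_eq_sub, SetLike.mem_coe]
    by_cases hwv : w = v
    · rw [hwv, sub_self]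
      exact zero_mem _
    · have h1 := hh w hw hwv
      have hmem : centralProj v h w ∈ vertexFigure V v h :=
        Finset.mem_image_of_mem _ (Finset.mem_erase.2 ⟨hwv, hw⟩)
      have heq : w - v = h (w - v) • (centralProj v h w - q) + h (w - v) • (q - v) := by
        rw [← smul_add, sub_add_sub_cancel, centralProj, add_sub_cancel_left, smul_smul,
          mul_inv_cancel₀ (by linarith), one_smul]
      rw [heq]
      exact Submodule.add_mem_sup
        (Submodule.smul_mem _ _ (vsub_mem_vectorSpan ℝ (Finset.mem_coe.2 hmem)
          (Finset.mem_coe.2 hq)))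
        (Submodule.smul_mem _ _ (Submodule.mem_span_singleton_self _))
  refine (Submodule.finrank_mono hle).trans
    ((Submodule.finrank_add_le_finrank_add_finrank _ _).trans ?_)
  gcongr
  exact (finrank_span_le_card _).trans (by simp)

end VertexFigure

/-! ### Complete graphs in the `1`-skeleton of a polytope -/

section Graph

namespace GraphEmbedding

variable {ι κ X Y : Type*} [TopologicalSpace X] [TopologicalSpace Y]

/-- The image of an embedded graph under an injective continuous map. -/
def map {G : SimpleGraph ι} (f : GraphEmbedding G X) (g : X → Y) (hg : Continuous g)
    (hinj : Function.Injective g) : GraphEmbedding G Y where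
  vertex := g ∘ f.vertex
  vertex_injective := hinj.comp f.vertex_injective
  arc h := (f.arc h).map hg
  arc_symm h := by rw [f.arc_symm, Path.map_symm]
  arc_injective h := hinj.comp (f.arc_injective h)
  arc_vertex h c hc := by
    obtain ⟨t, ht⟩ := hc
    exact f.arc_vertex h c ⟨t, hinj ht⟩
  arc_inter h h' hne := by
    rintro _ ⟨⟨t, rfl⟩, ⟨s, hs⟩⟩
    obtain ⟨c, hc⟩ := f.arc_inter h h' hne ⟨⟨t, rfl⟩, ⟨s, hinj hs⟩⟩
    exact ⟨c, congrArg g hc⟩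

/-- Renaming the vertices of an embedded complete graph. -/
def relabel (f : GraphEmbedding (⊤ : SimpleGraph ι) X) (e : κ ≃ ι) :
    GraphEmbedding (⊤ : SimpleGraph κ) X where
  vertex := f.vertex ∘ e
  vertex_injective := f.vertex_injective.comp e.injective
  arc h := f.arc (e.injective.ne h)
  arc_symm h := f.arc_symm _
  arc_injective h := f.arc_injective _
  arc_vertex h c hc := (f.arc_vertex _ _ hc).imp (fun h => e.injective h) (fun h => e.injective h)
  arc_inter {a b c d} h h' hne := by
    have hne' : s(e a, e b) ≠ s(e c, e d) := by
      intro heq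
      apply hne
      have : Sym2.map e s(a, b) = Sym2.map e s(c, d) := heq
      exact Sym2.map.injective e.injective this
    refine (f.arc_inter _ _ hne').trans ?_
    rintro _ ⟨i, rfl⟩
    exact ⟨e.symm i, by simp⟩

/-- The cone over an embedded complete graph: a new vertex `v` is joined by arcs `γ i` to the
vertices. The old graph lies in a set `Z` which each new arc meets only in its end point. -/
def cone (f : GraphEmbedding (⊤ : SimpleGraph ι) X) (v : X) (γ : ∀ i, Path v (f.vertex i))
    (Z : Set X) (hvert : ∀ i, f.vertex i ∈ Z)
    (harc : ∀ {a b : ι} (h : (⊤ : SimpleGraph ι).Adj a b) t, f.arc h t ∈ Z)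
    (hγ : ∀ i, Function.Injective (γ i)) (hγZ : ∀ i t, γ i t ∈ Z → t = 1)
    (hγγ : ∀ i j s t, γ i s = γ j t → i = j ∨ s = 0) :
    GraphEmbedding (⊤ : SimpleGraph (Option ι)) X :=
  have hv : ∀ _ : ι, v ∉ Z := fun i hmem => zero_ne_one (hγZ i 0 (by simpa using hmem))
  { vertex := fun o => o.elim v f.vertex
    vertex_injective := by
      rintro (_ | i) (_ | j) h
      · rfl
      · exact absurd ((show v = f.vertex j from h) ▸ hvert j : v ∈ Z) (hv j)
      · exact absurd ((show f.vertex i = v from h) ▸ hvert i : v ∈ Z) (hv i)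
      · exact congrArg some (f.vertex_injective h)
    arc := fun {a b} h =>
      match a, b, h with
      | none, none, h => absurd rfl h
      | none, some j, _ => γ j
      | some i, none, _ => (γ i).symm
      | some i, some j, h => f.arc (a := i) (b := j) (fun e => h (congrArg some e))
    arc_symm := by
      rintro (_ | i) (_ | j) h
      · exact absurd rfl h
      · rfl
      · exact (Path.symm_symm _).symm
      · exact f.arc_symm _
    arc_injective := by
      rintro (_ | i) (_ | j) h
      · exact absurd rfl h
      · exact hγ j
      · exact (hγ i).comp unitInterval.symm_bijective.injective
      · exact f.arc_injective _
    arc_vertex := by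
      have key : ∀ (j : ι) (c : Option ι) (t : unitInterval), γ j t = c.elim v f.vertex →
          c = none ∨ c = some j := by
        rintro j (_ | c) t ht
        · exact Or.inl rfl
        · have h1 : t = 1 := hγZ j t (ht ▸ hvert c)
          rw [h1, (γ j).target] at ht
          exact Or.inr (congrArg some (f.vertex_injective ht).symm)
      rintro (_ | i) (_ | j) h c ⟨t, ht⟩
      · exact absurd rfl h
      · exact key j c t ht
      · exact (key i c _ ht).symm
      · cases c with
        | none => exact absurd ((show f.arc _ t = v from ht) ▸ harc _ t : v ∈ Z) (hv i)
        | some c => exact (f.arc_vertex _ c ⟨t, ht⟩).imp (congrArg some) (congrArg some)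
    arc_inter := by
      have new_new : ∀ {i j s t}, i ≠ j → γ i s = γ j t →
          γ i s ∈ Set.range fun o : Option ι => o.elim v f.vertex := by
        intro i j s t hij heq
        rcases hγγ i j s t heq with h | rfl
        · exact absurd h hij
        · exact ⟨none, (γ i).source.symm⟩
      have new_old : ∀ {i s}, γ i s ∈ Z →
          γ i s ∈ Set.range fun o : Option ι => o.elim v f.vertex := by
        intro i s hmem
        rw [hγZ i s hmem]
        exact ⟨some i, (γ i).target.symm⟩
      rintro (_ | a) (_ | b) (_ | c) (_ | d) h h' hne x ⟨⟨s, rfl⟩, ⟨t, ht⟩⟩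
      · exact absurd rfl h
      · exact absurd rfl h
      · exact absurd rfl h
      · exact absurd rfl h
      · exact absurd rfl h'
      · exact new_new (fun e => hne (by rw [e])) ht.symm
      · exact new_new (fun e => hne (by rw [e, Sym2.eq_swap])) ht.symm
      · exact new_old (ht ▸ harc _ t)
      · exact absurd rfl h'
      · exact new_new (fun e => hne (by rw [e, Sym2.eq_swap])) ht.symm
      · exact new_new (fun e => hne (by rw [e])) ht.symm
      · exact new_old (i := a) (s := unitInterval.symm s) (ht ▸ harc _ t)
      · exact absurd rfl h'
      · exact ht ▸ new_old (i := d) (s := t) (ht ▸ harc _ s)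
      · exact ht ▸ new_old (i := c) (s := unitInterval.symm t) (ht ▸ harc _ s)
      · have hne' : s(a, b) ≠ s(c, d) := by
          intro heq
          apply hne
          have := congrArg (Sym2.map some) heq
          exact this
        obtain ⟨e, he⟩ := f.arc_inter (a := a) (b := b) (c := c) (d := d)
          (fun e => h (congrArg some e)) (fun e => h' (congrArg some e)) hne' ⟨⟨s, rfl⟩, ⟨t, ht⟩⟩
        exact ⟨some e, he⟩ }

end GraphEmbedding

variable {E : Type*} [NormedAddCommGroup E] [NormedSpace ℝ E]

/-- A linear function that is larger on the other vertices of a polytope than on a given one. -/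
lemma exists_height {V : Finset E} {v : E}
    (hv : v ∈ (convexHull ℝ (V : Set E)).extremePoints ℝ) :
    ∃ h : E →L[ℝ] ℝ, ∀ w ∈ V, w ≠ v → 1 < h (w - v) := by
  classical
  have hnot : v ∉ convexHull ℝ ((V.erase v : Finset E) : Set E) := by
    intro hmem
    have hconv := (convex_convexHull ℝ (V : Set E)).mem_extremePoints_iff_convex_sdiff.1 hv
    have hsub : ((V.erase v : Finset E) : Set E) ⊆ convexHull ℝ (V : Set E) \ {v} := fun w hw =>
      ⟨subset_convexHull ℝ _ (Finset.mem_coe.2 (Finset.mem_of_mem_erase hw)),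
        Finset.ne_of_mem_erase hw⟩
    exact (convexHull_min hsub hconv.2 hmem).2 rfl
  obtain ⟨f, u, hfv, hfu⟩ := geometric_hahn_banach_point_closed (convex_convexHull ℝ _)
    ((V.erase v).finite_toSet.isCompact_convexHull (𝕜 := ℝ)).isClosed hnot
  refine ⟨(u - f v)⁻¹ • f, fun w hw hwv => ?_⟩
  have := hfu w (subset_convexHull ℝ _ (Finset.mem_coe.2 (Finset.mem_erase.2 ⟨hwv, hw⟩)))
  have hpos : 0 < u - f v := sub_pos.2 hfv
  rw [FunLike.coe_smul, Pi.smul_apply, map_sub, smul_eq_mul]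
  rw [inv_mul_eq_div, lt_div_iff₀ hpos]
  linarith

variable [FiniteDimensional ℝ E]

/-- Grünbaum's theorem, in its topological form: the `1`-skeleton of a polytope of dimension at
least `m` contains an embedded complete graph on `m + 1` vertices, whose vertices are vertices of
the polytope. By induction it holds for the vertex figure at a vertex `v`; the radial homeomorphism
from the vertex figure to the far side of the polytope preserves skeleta, and the segments from `v`
to the new vertices are edges. -/
theorem exists_completeGraph_skeleton (m : ℕ) : ∀ (V : Finset E), V.Nonempty →
    m ≤ Module.finrank ℝ (vectorSpan ℝ (V : Set E)) →
    ∃ (ι : Type) (_ : Fintype ι), Fintype.card ι = m + 1 ∧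
      ∃ f : GraphEmbedding (⊤ : SimpleGraph ι) (skeleton 1 (convexHull ℝ (V : Set E))),
        ∀ i, (f.vertex i : E) ∈ skeleton 0 (convexHull ℝ (V : Set E)) := by
  classical
  induction m with
  | zero =>
    intro V hV _
    obtain ⟨v, hv⟩ := (V.finite_toSet.isCompact_convexHull (𝕜 := ℝ)).extremePoints_nonempty
      (hV.to_set.convexHull (𝕜 := ℝ))
    have h0 := faceDir_eq_bot_of_mem_extremePoints (convex_convexHull ℝ _) hv
    have hadj : ∀ {a b : Unit}, ¬ (⊤ : SimpleGraph Unit).Adj a b := fun h => h rfl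
    refine ⟨Unit, inferInstance, rfl,
      { vertex := fun _ => ⟨v, hv.1, by rw [h0]; simp⟩
        vertex_injective := fun _ _ _ => rfl
        arc := fun h => absurd h hadj
        arc_symm := fun h => absurd h hadj
        arc_injective := fun h => absurd h hadj
        arc_vertex := fun h => absurd h hadj
        arc_inter := fun h => absurd h hadj }, fun _ => ⟨hv.1, by rw [h0]; simp⟩⟩
  | succ m ih =>
    intro V hV hdim
    obtain ⟨v, hvext⟩ := (V.finite_toSet.isCompact_convexHull (𝕜 := ℝ)).extremePoints_nonempty
      (hV.to_set.convexHull (𝕜 := ℝ))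
    have hv : v ∈ V := extremePoints_convexHull_subset hvext
    obtain ⟨h, hh⟩ := exists_height hvext
    have hne : (vertexFigure V v h).Nonempty := by
      by_contra hemp
      rw [Finset.not_nonempty_iff_eq_empty, vertexFigure, Finset.image_eq_empty] at hemp
      have : V = {v} := by rw [← Finset.insert_erase hv, hemp]; rfl
      rw [this, Finset.coe_singleton, vectorSpan_singleton] at hdim
      simp at hdim
    obtain ⟨q₀, hq₀⟩ := hne
    have hdim' := finrank_vectorSpan_le_vertexFigure hv hh hq₀
    have hind := ih (vertexFigure V v h) ⟨q₀, hq₀⟩ (by omega)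
    have hradial := exists_homeomorph_farSide hv hh
    set P := convexHull ℝ (V : Set E) with hPdef
    set Q := convexHull ℝ (vertexFigure V v h : Set E) with hQdef
    obtain ⟨ι, hι, hcard, f, hf⟩ := hind
    obtain ⟨ρ, hρ⟩ := hradial
    have hP : Convex ℝ P := convex_convexHull ℝ _
    have hvP : v ∈ P := hvext.1
    have hseg : ∀ q : Q, (q : E) ∈ openSegment ℝ v (ρ q : E) := fun q => by
      have := mem_openSegment_centralProj (one_lt_of_mem_farSide hv hh (ρ q).2)
      rwa [hρ] at this
    have hqP : ∀ q : Q, Module.finrank ℝ (faceDir P (q : E)) ≤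
        Module.finrank ℝ (faceDir Q (q : E)) + 1 := fun q =>
      finrank_faceDir_le_vertexFigure hv hh q.2
        (sub_mem_faceDir_of_mem_openSegment hP hvP (ρ q).2.1 (hseg q))
    have hρdim : ∀ q : Q, Module.finrank ℝ (faceDir P (ρ q : E)) ≤
        Module.finrank ℝ (faceDir Q (q : E)) := fun q => by
      have h1 := finrank_faceDir_lt_of_mem_farSide hv hh (ρ q).2
      rw [hρ, ← hPdef] at h1
      have := hqP q
      omega
    let g : skeleton 1 Q → skeleton 1 P := fun q =>
      ⟨ρ ⟨q, q.2.1⟩, (ρ ⟨q, q.2.1⟩).2.1, (hρdim ⟨q, q.2.1⟩).trans q.2.2⟩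
    have hg : Continuous g :=
      (continuous_subtype_val.comp (ρ.continuous.comp (by fun_prop))).subtype_mk _
    have hginj : Function.Injective g := by
      intro q q' heq
      have h1 : (ρ ⟨q, q.2.1⟩ : E) = ρ ⟨q', q'.2.1⟩ :=
        congrArg (fun x : skeleton 1 P => (x : E)) heq
      have h2 := ρ.injective (Subtype.ext h1)
      exact Subtype.ext (Subtype.mk.inj h2)
    have hv0 := faceDir_eq_bot_of_mem_extremePoints hP hvext
    have hgZ : ∀ q, (g q : E) ∈ farSide P v := fun q => (ρ ⟨q, q.2.1⟩).2
    have hpath : ∀ i (t : unitInterval), v + (t : ℝ) • ((g (f.vertex i) : E) - v) ∈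
        skeleton 1 P := by
      intro i t
      have hw := hgZ (f.vertex i)
      set q : Q := ⟨f.vertex i, (f.vertex i).2.1⟩ with hqdef
      have hgq : (g (f.vertex i) : E) = ρ q := rfl
      have hq0 : Module.finrank ℝ (faceDir Q (q : E)) = 0 := Nat.le_zero.1 (hf i).2
      rcases t.2.1.eq_or_lt with h0 | h0
      · rw [← h0, zero_smul, add_zero]
        exact ⟨hvP, by rw [hv0]; simp⟩
      rcases t.2.2.eq_or_lt with h1 | h1
      · rw [h1, one_smul, add_sub_cancel]
        exact (g (f.vertex i)).2
      · have hmem : v + (t : ℝ) • ((g (f.vertex i) : E) - v) ∈ openSegment ℝ v (ρ q : E) :=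
          ⟨1 - t, t, by linarith, h0, by ring, by rw [hgq]; module⟩
        refine ⟨hP.openSegment_subset hvP (ρ q).2.1 hmem, ?_⟩
        have h1 := Submodule.finrank_mono (faceDir_le_of_mem_openSegment_of_mem_openSegment hP hvP
          (ρ q).2.1 hmem (hseg q))
        have h2 := hqP q
        omega
    let γ : ∀ i, Path (⟨v, hvP, by rw [hv0]; simp⟩ : skeleton 1 P) ((f.map g hg hginj).vertex i) :=
      fun i =>
      { toFun := fun t => ⟨v + (t : ℝ) • ((g (f.vertex i) : E) - v), hpath i t⟩
        continuous_toFun := by fun_prop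
        source' := by simp
        target' := by simp [GraphEmbedding.map] }
    have hwv : ∀ i, (g (f.vertex i) : E) - v ≠ 0 := fun i =>
      sub_ne_zero.2 (hgZ (f.vertex i)).2.1
    refine ⟨Option ι, inferInstance, by rw [Fintype.card_option, hcard],
      (f.map g hg hginj).cone ⟨v, hvP, by rw [hv0]; simp⟩ γ {x | (x : E) ∈ farSide P v}
        (fun i => hgZ _) (fun h t => hgZ _) ?_ ?_ ?_, ?_⟩
    · intro i s t hst
      have h1 : v + (s : ℝ) • ((g (f.vertex i) : E) - v) = v + (t : ℝ) • ((g (f.vertex i) : E) - v)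
        := congrArg Subtype.val hst
      rw [add_right_inj] at h1
      exact Subtype.ext (smul_left_injective ℝ (hwv i) h1)
    · intro i t hmem
      by_contra hne
      have ht1 : (t : ℝ) < 1 := lt_of_le_of_ne t.2.2 fun e => hne (Subtype.ext e)
      have hmem' : v + (t : ℝ) • ((g (f.vertex i) : E) - v) ∈ farSide P v := hmem
      have ht0 : 0 < (t : ℝ) := by
        refine lt_of_le_of_ne t.2.1 fun e => ?_
        rw [← e, zero_smul, add_zero] at hmem'
        exact hmem'.2.1 rfl
      refine hmem'.2.2 ⟨1 / (t : ℝ) - 1, by rw [sub_pos, lt_div_iff₀ ht0]; linarith, ?_⟩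
      convert! (g (f.vertex i)).2.1 using 1
      match_scalars <;> field_simp <;> ring
    · intro i j s t hst
      by_contra! hcon
      obtain ⟨hij, hs⟩ := hcon
      have hs0 : 0 < (s : ℝ) := lt_of_le_of_ne s.2.1 fun e => hs (Subtype.ext e.symm)
      have h1 : v + (s : ℝ) • ((g (f.vertex i) : E) - v) = v + (t : ℝ) • ((g (f.vertex j) : E) - v)
        := congrArg Subtype.val hst
      rw [add_right_inj] at h1
      have h2 := congrArg h h1
      simp only [map_smul, smul_eq_mul] at h2
      have hi := one_lt_of_mem_farSide hv hh (hgZ (f.vertex i))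
      have hj := one_lt_of_mem_farSide hv hh (hgZ (f.vertex j))
      -- the two segments lie on the same ray, so their ends have the same central projection
      have hproj : centralProj v h (g (f.vertex i)) = centralProj v h (g (f.vertex j)) := by
        simp only [centralProj]
        congr 1
        rw [← inv_smul_smul₀ hs0.ne' ((g (f.vertex i) : E) - v), h1, map_smul, map_smul, smul_smul,
          smul_smul]
        congr 1
        have ht0 : (t : ℝ) ≠ 0 := by
          intro h0
          rw [h0] at h2
          nlinarith
        simp only [smul_eq_mul]
        field_simp
      have := hginj (Subtype.ext (centralProj_injOn_farSide hv hh (hgZ _) (hgZ _) hproj))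
      exact hij (f.vertex_injective this)
    · rintro (_ | i)
      · exact ⟨hvP, by change Module.finrank ℝ (faceDir P v) ≤ 0; rw [hv0]; simp⟩
      · exact ⟨(g (f.vertex i)).2.1, (hρdim _).trans (hf i).2⟩

end Graph

/-! ### The two-piece property and the edges of the convex hull -/

section TwoPiece

variable {E : Type*} [NormedAddCommGroup E] [NormedSpace ℝ E]

/-- A compact set whose intersections with the open half-spaces `c < f x` are connected meets its
supporting hyperplane in the direction of `f` in a connected set. -/
lemma isPreconnected_inter_supportingHyperplane {M : Set E} (hM : IsCompact M) {f : E →L[ℝ] ℝ}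
    (htpp : ∀ c, IsPreconnected (M ∩ {y | c < f y})) {c : ℝ} (hc : ∀ y ∈ M, f y ≤ c) :
    IsPreconnected (M ∩ {y | f y = c}) := by
  set C := M ∩ {y | f y = c} with hCdef
  have hC : IsCompact C := hM.inter_right (isClosed_eq f.continuous continuous_const)
  intro u v hu hv huv ⟨a, haC, hau⟩ ⟨b, hbC, hbv⟩
  by_contra hemp
  rw [Set.not_nonempty_iff_eq_empty] at hemp
  have hdisj : Disjoint (C \ v) (C \ u) := by
    rw [Set.disjoint_left]
    rintro x ⟨hxC, hxv⟩ ⟨-, hxu⟩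
    exact (huv hxC).elim hxu hxv
  obtain ⟨U₁, U₂, hU₁, hU₂, h1, h2, h12⟩ :=
    SeparatedNhds.of_isCompact_isCompact (hC.diff hv) (hC.diff hu) hdisj
  have hmem : ∀ x ∈ C, x ∈ U₁ ∪ U₂ := by
    intro x hx
    by_cases hxv : x ∈ v
    · refine Or.inr (h2 ⟨hx, fun hxu => ?_⟩)
      have : x ∈ C ∩ (u ∩ v) := ⟨hx, hxu, hxv⟩
      rw [hemp] at this
      exact this
    · exact Or.inl (h1 ⟨hx, hxv⟩)
  -- outside the two open sets `f` stays away from its maximum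
  obtain ⟨c', hc', hc'M⟩ : ∃ c' < c, ∀ x ∈ M \ (U₁ ∪ U₂), f x ≤ c' := by
    have hK : IsCompact (M \ (U₁ ∪ U₂)) := hM.diff (hU₁.union hU₂)
    rcases (M \ (U₁ ∪ U₂)).eq_empty_or_nonempty with h0 | hne
    · exact ⟨c - 1, by linarith, by simp [h0]⟩
    · obtain ⟨x, hx, hmax⟩ := hK.exists_isMaxOn hne f.continuous.continuousOn
      exact ⟨f x, lt_of_le_of_ne (hc x hx.1) fun h => hx.2 (hmem x ⟨hx.1, h⟩), hmax⟩
  have hsub : M ∩ {y | c' < f y} ⊆ U₁ ∪ U₂ := by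
    rintro x ⟨hxM, hx⟩
    by_contra hxU
    exact absurd (hc'M x ⟨hxM, hxU⟩) (not_le.2 hx)
  have hCsub : ∀ x ∈ C, x ∈ M ∩ {y | c' < f y} := fun x hx =>
    ⟨hx.1, by rw [Set.mem_ofPred_eq, show f x = c from hx.2]; exact hc'⟩
  have hav : a ∉ v := fun h => by
    have : a ∈ C ∩ (u ∩ v) := ⟨haC, hau, h⟩
    rw [hemp] at this
    exact this
  have hbu : b ∉ u := fun h => by
    have : b ∈ C ∩ (u ∩ v) := ⟨hbC, h, hbv⟩
    rw [hemp] at this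
    exact this
  obtain ⟨x, -, hx1, hx2⟩ := htpp c' U₁ U₂ hU₁ hU₂ hsub ⟨a, hCsub a haC, h1 ⟨haC, hav⟩⟩
    ⟨b, hCsub b hbC, h2 ⟨hbC, hbu⟩⟩
  exact Set.disjoint_left.1 h12 hx1 hx2

variable [FiniteDimensional ℝ E]

/-- Faces of polytopes are exposed. -/
lemma exists_exposing_functional {V : Finset E} {x : E} (hx : x ∈ convexHull ℝ (V : Set E)) :
    ∃ f : E →L[ℝ] ℝ, ∀ p ∈ convexHull ℝ (V : Set E),
      f p ≤ f x ∧ (f p = f x → p - x ∈ faceDir (convexHull ℝ (V : Set E)) x) := by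
  classical
  have hP := convex_convexHull ℝ (V : Set E)
  set L := faceDir (convexHull ℝ (V : Set E)) x with hL
  -- it is enough to treat the points of `V`, with strict inequality outside the face
  suffices h : ∃ f : E →L[ℝ] ℝ, ∀ w ∈ V, f w ≤ f x ∧ (f w = f x → w - x ∈ L) by
    obtain ⟨f, hf⟩ := h
    refine ⟨f, fun p hp => convexHull_min (t := {p | f p ≤ f x ∧ (f p = f x → p - x ∈ L)}) hf ?_ hp⟩
    rintro a ⟨ha, ha'⟩ b ⟨hb, hb'⟩ s t hs ht hst
    have hval : f (s • a + t • b) = s * f a + t * f b := by simp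
    have hsum : s * f x + t * f x = f x := by rw [← add_mul, hst, one_mul]
    have hsa := mul_le_mul_of_nonneg_left ha hs
    have htb := mul_le_mul_of_nonneg_left hb ht
    have hle : s * f a + t * f b ≤ f x := by linarith
    refine ⟨hval ▸ hle, fun heq => ?_⟩
    rw [hval] at heq
    have hconv := convex_setOf_sub_mem L x
    rcases hs.eq_or_lt with rfl | hs'
    · obtain rfl : t = 1 := by linarith
      rw [zero_smul, zero_add, one_smul]
      exact hb' (by simpa using heq)
    rcases ht.eq_or_lt with rfl | ht'
    · obtain rfl : s = 1 := by linarith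
      rw [zero_smul, add_zero, one_smul]
      exact ha' (by simpa using heq)
    exact hconv (ha' (mul_left_cancel₀ hs'.ne' (by linarith)))
      (hb' (mul_left_cancel₀ ht'.ne' (by linarith))) hs ht hst
  set W := V.filter fun w => w - x ∉ L with hW
  have hWV : convexHull ℝ (W : Set E) ⊆ convexHull ℝ (V : Set E) :=
    convexHull_mono (Finset.coe_subset.2 (Finset.filter_subset _ _))
  have hdisj : Disjoint {y | y - x ∈ L} (convexHull ℝ (W : Set E)) := by
    rw [Set.disjoint_left]
    intro y hyL hyW
    obtain ⟨w, hw, hwy⟩ : {w | w ∈ W ∧ w - y ∈ faceDir (convexHull ℝ (W : Set E)) y}.Nonempty := by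
      rw [← convexHull_nonempty_iff (𝕜 := ℝ)]
      exact ⟨y, mem_convexHull_face hyW⟩
    obtain ⟨ε, hε, hmem⟩ := ((mem_faceDir (convex_convexHull ℝ _) hyW).1 hwy).2
    have h1 : IsFeasible (convexHull ℝ (V : Set E)) x (-(w - y)) :=
      IsFeasible.of_sub_mem_faceDir hP hx hyL ⟨ε, hε, hWV hmem⟩
    have h2 := ((mem_faceDir hP hx).1 hyL).2
    refine (Finset.mem_filter.1 hw).2 (sub_mem_faceDir hP hx
      (subset_convexHull ℝ _ (Finset.mem_coe.2 (Finset.mem_filter.1 hw).1)) ?_)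
    convert! h1.add hP hx h2 using 1
    abel
  obtain ⟨f, s, t, hfs, hst, hft⟩ := geometric_hahn_banach_closed_compact
    (convex_setOf_sub_mem L x) (L.closed_of_finiteDimensional.preimage (by fun_prop :
      Continuous fun y : E => y - x)) (convex_convexHull ℝ _)
    (W.finite_toSet.isCompact_convexHull (𝕜 := ℝ)) hdisj
  have hf0 : ∀ l ∈ L, f l = 0 := by
    intro l hl
    by_contra hne
    have := hfs (x + ((s - f x) / f l) • l) (by
      change x + ((s - f x) / f l) • l - x ∈ L
      rw [add_sub_cancel_left]
      exact L.smul_mem _ hl)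
    rw [map_add, map_smul, smul_eq_mul, div_mul_cancel₀ _ hne] at this
    linarith
  have hfx := hfs x (by change x - x ∈ L; rw [sub_self]; exact zero_mem _)
  refine ⟨-f, fun w hw => ?_⟩
  by_cases hwL : w - x ∈ L
  · have := hf0 _ hwL
    rw [map_sub] at this
    exact ⟨by simp only [FunLike.coe_neg, Pi.neg_apply]; linarith, fun _ => hwL⟩
  · have := hft w (subset_convexHull ℝ _ (Finset.mem_coe.2 (Finset.mem_filter.2 ⟨hw, hwL⟩)))
    simp only [FunLike.coe_neg, Pi.neg_apply]
    exact ⟨by linarith, fun h => by linarith⟩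

/-- A connected subset of a line is convex. -/
lemma convex_of_isPreconnected_of_finrank_le_one {C : Set E} (hC : IsPreconnected C)
    {L : Submodule ℝ E} (hL : Module.finrank ℝ L ≤ 1) {x : E} (hx : ∀ p ∈ C, p - x ∈ L) :
    Convex ℝ C := by
  obtain ⟨⟨u, huL⟩, hu⟩ := finrank_le_one_iff.1 hL
  have hu' : ∀ l ∈ L, ∃ c : ℝ, c • u = l := fun l hl => by
    obtain ⟨c, hc⟩ := hu ⟨l, hl⟩
    exact ⟨c, congrArg Subtype.val hc⟩
  by_cases hu0 : u = 0
  · refine Set.Subsingleton.convex fun p hp p' hp' => ?_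
    have key : ∀ p ∈ C, p = x := fun p hp => by
      obtain ⟨c, hc⟩ := hu' _ (hx p hp)
      rw [hu0, smul_zero] at hc
      exact sub_eq_zero.1 hc.symm
    rw [key p hp, key p' hp']
  obtain ⟨ψ, hψ⟩ := SeparatingDual.exists_eq_one (R := ℝ) hu0
  have hψC : Convex ℝ (ψ '' C) :=
    (hC.image ψ ψ.continuous.continuousOn).ordConnected.convex
  have hinj : ∀ p p', p - x ∈ L → p' - x ∈ L → ψ p = ψ p' → p = p' := by
    intro p p' hp hp' heq
    obtain ⟨c, hc⟩ := hu' _ (L.sub_mem hp hp')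
    rw [sub_sub_sub_cancel_right] at hc
    have h1 := congrArg ψ hc
    rw [map_smul, hψ, map_sub, heq, sub_self, smul_eq_mul, mul_one] at h1
    rw [h1, zero_smul] at hc
    exact sub_eq_zero.1 hc.symm
  intro p hp p' hp' a b ha hb hab
  obtain ⟨p'', hp'', heq⟩ := hψC ⟨p, hp, rfl⟩ ⟨p', hp', rfl⟩ ha hb hab
  rw [← map_smul, ← map_smul, ← map_add] at heq
  rwa [← hinj p'' _ (hx _ hp'')
    (convex_setOf_sub_mem L x (hx _ hp) (hx _ hp') ha hb hab) heq]

/-- A compact set with the two-piece property contains the vertices and edges of its convex hull. -/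
theorem skeleton_one_subset {M : Set E} (hM : IsCompact M)
    (htpp : ∀ (f : E →L[ℝ] ℝ) (c : ℝ), IsPreconnected (M ∩ {y | c < f y})) {V : Finset E}
    (hVM : (V : Set E) ⊆ M) (hMV : M ⊆ convexHull ℝ (V : Set E)) :
    skeleton 1 (convexHull ℝ (V : Set E)) ⊆ M := by
  rintro x ⟨hx, hdim⟩
  obtain ⟨f, hf⟩ := exists_exposing_functional hx
  have hC := isPreconnected_inter_supportingHyperplane hM (htpp f) fun y hy => (hf y (hMV hy)).1
  have hconv := convex_of_isPreconnected_of_finrank_le_one hC hdim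
    fun p hp => (hf p (hMV hp.1)).2 hp.2
  refine (convexHull_min ?_ hconv (mem_convexHull_face hx)).1
  rintro w ⟨hw, hwL⟩
  refine ⟨hVM hw, le_antisymm (hf w (hMV (hVM hw))).1 ?_⟩
  -- the functional is also maximal at `w`, because the polytope extends beyond `x` seen from `w`
  obtain ⟨ε, hε, hmem⟩ := ((mem_faceDir (convex_convexHull ℝ _) hx).1 hwL).2
  have := (hf _ hmem).1
  simp only [map_add, map_smul, map_neg, map_sub, smul_eq_mul] at this
  nlinarith

end TwoPiece

/-! ### Moving points inside a chart -/

section Transplant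

variable {F S : Type*} [TopologicalSpace F] [TopologicalSpace S]

open Classical in
/-- Transplanting a self-map of the model space to a space by means of a chart. -/
def transplant (ψ : OpenPartialHomeomorph S F) (h : F → F) (s : S) : S :=
  if s ∈ ψ.source then ψ.symm (h (ψ s)) else s

lemma transplant_comp (ψ : OpenPartialHomeomorph S F) {h k : F → F}
    (hk : ∀ z ∈ ψ.target, k z ∈ ψ.target) (hkh : ∀ z, h (k z) = z) (s : S) :
    transplant ψ h (transplant ψ k s) = s := by
  by_cases hs : s ∈ ψ.source
  · have h1 := hk _ (ψ.map_source hs)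
    rw [transplant, transplant, if_pos hs, if_pos (ψ.map_target h1), ψ.right_inv h1, hkh,
      ψ.left_inv hs]
  · rw [transplant, transplant, if_neg hs, if_neg hs]

lemma continuous_transplant [T2Space S] (ψ : OpenPartialHomeomorph S F) {h : F → F}
    (hh : Continuous h)
    {B : Set F} (hB : IsCompact B) (hBt : B ⊆ ψ.target) (hfix : ∀ z, z ∉ B → h z = z)
    (ht : ∀ z ∈ ψ.target, h z ∈ ψ.target) : Continuous (transplant ψ h) := by
  have hK : IsCompact (ψ.symm '' B) := hB.image_of_continuousOn (ψ.continuousOn_symm.mono hBt)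
  have h1 : ContinuousOn (transplant ψ h) ψ.source := by
    have : ContinuousOn (fun s => ψ.symm (h (ψ s))) ψ.source :=
      ψ.continuousOn_symm.comp (hh.comp_continuousOn ψ.continuousOn)
        fun s hs => ht _ (ψ.map_source hs)
    exact this.congr fun s hs => if_pos hs
  have h2 : ContinuousOn (transplant ψ h) (ψ.symm '' B)ᶜ := by
    refine continuousOn_id.congr fun s hs => ?_
    by_cases hs' : s ∈ ψ.source
    · rw [transplant, if_pos hs', hfix _ fun hmem => hs ⟨_, hmem, ψ.left_inv hs'⟩, ψ.left_inv hs']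
      rfl
    · exact if_neg hs'
  have := h1.union_of_isOpen h2 ψ.open_source hK.isClosed.isOpen_compl
  rw [← continuousOn_univ]
  refine this.mono fun s _ => ?_
  by_cases hs : s ∈ ψ.source
  · exact Or.inl hs
  · refine Or.inr ?_
    rintro ⟨z, hz, rfl⟩
    exact hs (ψ.map_target (hBt hz))

end Transplant

section Push

open Metric

variable {F : Type*} [NormedAddCommGroup F] [NormedSpace ℝ F] [ProperSpace F]

/-- Any two points of a small ball are exchanged by a homeomorphism supported in a larger ball. -/
lemma exists_homeomorph_push {p₀ p p' : F} {r : ℝ} (hr : 0 < r) (hp : p ∈ ball p₀ (r / 4))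
    (hp' : p' ∈ ball p₀ (r / 4)) :
    ∃ h : F ≃ₜ F, h p = p' ∧ ∀ z, z ∉ closedBall p₀ r → h z = z := by
  have hpp : ‖p' - p‖ < r / 2 := by
    rw [← dist_eq_norm]
    rw [mem_ball] at hp hp'
    have := dist_triangle_right p' p p₀
    linarith
  let f : F → F := fun z => z + max 0 (1 - ‖z - p‖ / (r / 2)) • (p' - p)
  let c : NNReal := ⟨‖p' - p‖ / (r / 2), by positivity⟩
  have hf : ApproximatesLinearOn f ((ContinuousLinearEquiv.refl ℝ F : F ≃L[ℝ] F) : F →L[ℝ] F)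
      Set.univ c := by
    intro z _ w _
    have e : f z - f w - ((ContinuousLinearEquiv.refl ℝ F : F ≃L[ℝ] F) : F →L[ℝ] F) (z - w) =
        (max 0 (1 - ‖z - p‖ / (r / 2)) - max 0 (1 - ‖w - p‖ / (r / 2))) • (p' - p) := by
      simp only [f, ContinuousLinearEquiv.coe_coe, ContinuousLinearEquiv.refl_apply]
      module
    rw [e, norm_smul, Real.norm_eq_abs]
    have h1 : |max 0 (1 - ‖z - p‖ / (r / 2)) - max 0 (1 - ‖w - p‖ / (r / 2))| ≤
        ‖z - w‖ / (r / 2) := by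
      rw [max_comm 0, max_comm 0]
      refine (abs_max_sub_max_le_abs _ _ (0 : ℝ)).trans ?_
      rw [sub_sub_sub_cancel_left, ← sub_div, abs_div, abs_of_pos (by positivity : 0 < r / 2)]
      gcongr
      refine (abs_norm_sub_norm_le _ _).trans (le_of_eq ?_)
      rw [sub_sub_sub_cancel_right, norm_sub_rev]
    calc _ ≤ ‖z - w‖ / (r / 2) * ‖p' - p‖ := by gcongr
      _ = (c : ℝ) * ‖z - w‖ := by
        change _ = ‖p' - p‖ / (r / 2) * ‖z - w‖
        ring
  have hc : Subsingleton F ∨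
      c < ‖((ContinuousLinearEquiv.refl ℝ F : F ≃L[ℝ] F).symm : F →L[ℝ] F)‖₊⁻¹ := by
    rcases subsingleton_or_nontrivial F with h | h
    · exact Or.inl h
    · right
      have h1 : ‖((ContinuousLinearEquiv.refl ℝ F : F ≃L[ℝ] F).symm : F →L[ℝ] F)‖₊ = 1 :=
        NNReal.eq (ContinuousLinearMap.norm_id (𝕜 := ℝ) (E := F))
      rw [h1, inv_one]
      refine NNReal.coe_lt_coe.1 ?_
      change ‖p' - p‖ / (r / 2) < 1
      rwa [div_lt_one (by positivity)]
  refine ⟨hf.toHomeomorph f hc, ?_, fun z hz => ?_⟩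
  · change f p = p'
    simp [f]
  · change f z = z
    have hzp : r / 2 ≤ ‖z - p‖ := by
      rw [← dist_eq_norm]
      rw [mem_closedBall, not_le] at hz
      rw [mem_ball] at hp
      have := dist_triangle z p p₀
      linarith
    have : 1 - ‖z - p‖ / (r / 2) ≤ 0 := by
      rw [sub_nonpos, one_le_div (by positivity)]
      exact hzp
    simp [f, max_eq_left this]

variable {S : Type*} [TopologicalSpace S] [T2Space S]

/-- The points near the centre of a chart are permuted transitively by homeomorphisms of the
whole space. -/
lemma exists_homeomorph_of_mem_chart (ψ : OpenPartialHomeomorph S F) {x : S}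
    (hx : x ∈ ψ.source) :
    ∃ U : Set S, IsOpen U ∧ x ∈ U ∧ ∀ y ∈ U, ∀ y' ∈ U, ∃ H : S ≃ₜ S, H y = y' := by
  obtain ⟨r, hr, hball⟩ := nhds_basis_closedBall.mem_iff.1
    (ψ.open_target.mem_nhds (ψ.map_source hx))
  refine ⟨ψ.source ∩ ψ ⁻¹' ball (ψ x) (r / 4), ψ.isOpen_inter_preimage isOpen_ball,
    ⟨hx, mem_ball_self (by positivity)⟩, ?_⟩
  rintro y ⟨hy, hyb⟩ y' ⟨hy', hyb'⟩
  obtain ⟨h, hh, hfix⟩ := exists_homeomorph_push hr hyb hyb'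
  have hfix' : ∀ z, z ∉ closedBall (ψ x) r → h.symm z = z := fun z hz => by
    rw [Homeomorph.symm_apply_eq, hfix z hz]
  -- a bijection that fixes the complement of the ball maps the ball to itself
  have hin : ∀ k k' : F → F, (∀ z, k' (k z) = z) → (∀ z, z ∉ closedBall (ψ x) r → k' z = z) →
      ∀ z ∈ closedBall (ψ x) r, k z ∈ closedBall (ψ x) r := by
    intro k k' hkk hk' z hz
    by_contra hcon
    have := hk' _ hcon
    rw [hkk] at this
    exact hcon (this ▸ hz)
  have htarget : ∀ k k' : F → F, (∀ z, k' (k z) = z) →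
      (∀ z, z ∉ closedBall (ψ x) r → k z = z) → (∀ z, z ∉ closedBall (ψ x) r → k' z = z) →
      ∀ z ∈ ψ.target, k z ∈ ψ.target := by
    intro k k' hkk hk hk' z hz
    by_cases hzb : z ∈ closedBall (ψ x) r
    · exact hball (hin k k' hkk hk' z hzb)
    · rwa [hk z hzb]
  have ht := htarget h h.symm h.symm_apply_apply hfix hfix'
  have ht' := htarget h.symm h h.apply_symm_apply hfix' hfix
  refine ⟨{ toFun := transplant ψ h
            invFun := transplant ψ h.symm
            left_inv := transplant_comp ψ ht h.symm_apply_apply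
            right_inv := transplant_comp ψ ht' h.apply_symm_apply
            continuous_toFun := continuous_transplant ψ h.continuous
              (isCompact_closedBall _ _) hball hfix ht
            continuous_invFun := continuous_transplant ψ h.symm.continuous
              (isCompact_closedBall _ _) hball hfix' ht' }, ?_⟩
  change transplant ψ h y = y'
  rw [transplant, if_pos hy, hh, ψ.left_inv hy']

end Push

/-! ### Points of a surface around which small loops bound -/

section Surface

/-- Small loops around `x` bound in the complement of `x`, as far as maps from the complement to
the circle can tell. In a surface with boundary, no interior point has this property. -/
def LoopsBound {S : Type*} [TopologicalSpace S] (x : S) : Prop :=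
  ∃ U : Set S, IsOpen U ∧ x ∈ U ∧ ∀ γ : C(Circle, S), (∀ u, γ u ∈ U ∧ γ u ≠ x) →
    ∀ g : S → Circle, ContinuousOn g {x}ᶜ → ∀ k : C(Circle, Circle), (∀ u, k u = g (γ u)) →
      homologyMap 1 k = 0

lemma LoopsBound.image {S T : Type*} [TopologicalSpace S] [TopologicalSpace T] {x : S}
    (h : LoopsBound x) (H : S ≃ₜ T) : LoopsBound (H x) := by
  obtain ⟨U, hU, hx, hloop⟩ := h
  refine ⟨H.symm ⁻¹' U, hU.preimage H.symm.continuous, by simpa, fun γ hγ g hg k hk => ?_⟩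
  refine hloop (ContinuousMap.comp ⟨H.symm, H.symm.continuous⟩ γ) (fun u => ⟨(hγ u).1, ?_⟩)
    (g ∘ H) (hg.comp H.continuous.continuousOn ?_) k (fun u => ?_)
  · intro heq
    apply (hγ u).2
    rw [← heq]
    simp
  · intro y hy heq
    exact hy (H.injective heq)
  · simp [hk u]

/-- The radial projection of the punctured plane to the circle. -/
def toCircle (z : ℂ) : Circle :=
  if hz : z = 0 then 1 else ⟨z / ‖z‖, mem_sphere_zero_iff_norm.2 (by
    rw [norm_div, Complex.norm_real, norm_norm, div_self (norm_ne_zero_iff.2 hz)])⟩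

lemma coe_toCircle {z : ℂ} (hz : z ≠ 0) : (toCircle z : ℂ) = z / ‖z‖ := by
  have h : toCircle z = ⟨z / ‖z‖, _⟩ := dif_neg hz
  exact congrArg (fun c : Circle => (c : ℂ)) h

lemma continuousOn_toCircle : ContinuousOn toCircle {0}ᶜ := by
  have h : ContinuousOn (fun z : ℂ => z / (‖z‖ : ℂ)) {0}ᶜ :=
    continuousOn_id.div (by fun_prop) fun z hz => by
      simpa using hz
  rw [continuousOn_iff_continuous_domRestrict] at h ⊢
  refine continuous_induced_rng.2 (h.congr fun z => ?_)
  exact (coe_toCircle z.2).symm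

lemma toCircle_ofReal {t : ℝ} (ht : 0 < t) : toCircle (t : ℂ) = 1 := by
  have h0 : (t : ℂ) ≠ 0 := by exact_mod_cast ht.ne'
  apply Circle.ext
  rw [coe_toCircle h0, Complex.norm_real, Real.norm_of_nonneg ht.le, div_self h0, Circle.coe_one]

lemma toCircle_coe (u : Circle) : toCircle (u : ℂ) = u := by
  apply Circle.ext
  rw [coe_toCircle u.coe_ne_zero, Circle.norm_coe]
  simp

/-- A map from the half-plane `-1 < u` to the complex plane that only vanishes at the origin, winds
once around it, and is positive real outside the half-strip `u < 1`, `|w| < 1`. -/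
def stripMap (u w : ℝ) : ℂ := ⟨u + 2 * |w|, w * (max 0 (1 - |w|) * max 0 (1 - u))⟩

lemma continuous_stripMap : Continuous fun p : ℝ × ℝ => stripMap p.1 p.2 := by
  have : (fun p : ℝ × ℝ => stripMap p.1 p.2) = fun p : ℝ × ℝ =>
      ((p.1 + 2 * |p.2| : ℝ) : ℂ) +
        ((p.2 * (max 0 (1 - |p.2|) * max 0 (1 - p.1)) : ℝ) : ℂ) * Complex.I := by
    funext p
    exact Complex.mk_eq_add_mul_I _ _
  rw [this]
  fun_prop

lemma stripMap_ne_zero {u w : ℝ} (hu : -1 < u) (huw : u ≠ 0 ∨ w ≠ 0) : stripMap u w ≠ 0 := by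
  intro h
  have hre : u + 2 * |w| = 0 := congrArg Complex.re h
  have him : w * (max 0 (1 - |w|) * max 0 (1 - u)) = 0 := congrArg Complex.im h
  have hw := abs_nonneg w
  have h1 : 0 < max 0 (1 - |w|) := lt_max_of_lt_right (by linarith)
  have h2 : 0 < max 0 (1 - u) := lt_max_of_lt_right (by linarith)
  have hw0 : w = 0 := by
    rcases mul_eq_zero.1 him with h | h
    · exact h
    · exact absurd h (mul_pos h1 h2).ne'
  subst hw0
  simp at hre
  rcases huw with h | h
  · exact h hre
  · exact h rfl

lemma toCircle_stripMap {u w : ℝ} (hu : -1 < u) (huw : 1 ≤ u ∨ 1 ≤ |w|) :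
    toCircle (stripMap u w) = 1 := by
  have hw := abs_nonneg w
  have h1 : max 0 (1 - |w|) * max 0 (1 - u) = 0 := by
    rcases huw with h | h
    · rw [max_eq_left (by linarith : 1 - u ≤ 0), mul_zero]
    · rw [max_eq_left (by linarith : 1 - |w| ≤ 0), zero_mul]
  have h2 : stripMap u w = ((u + 2 * |w| : ℝ) : ℂ) := by
    rw [stripMap, h1, mul_zero]
    rfl
  rw [h2]
  refine toCircle_ofReal ?_
  rcases huw with h | h <;> linarith

/-- On a small circle around the origin the strip map is homotopic to the identity. -/
lemma homologyMap_stripMap_ne_zero {ρ : ℝ} (hρ : 0 < ρ) (hρ1 : ρ < 1) (k : C(Circle, Circle))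
    (hk : ∀ c : Circle, k c = toCircle (stripMap (ρ * (c : ℂ).re) (ρ * (c : ℂ).im))) :
    homologyMap 1 k ≠ 0 := by
  let G : unitInterval × Circle → ℂ := fun p =>
    ((1 - (p.1 : ℝ) : ℝ) : ℂ) * stripMap (ρ * (p.2 : ℂ).re) (ρ * (p.2 : ℂ).im) +
      ((p.1 : ℝ) : ℂ) * (p.2 : ℂ)
  have hcoe : Continuous fun p : unitInterval × Circle => (p.2 : ℂ) :=
    continuous_induced_dom.comp continuous_snd
  have hG : Continuous G := by
    have h1 : Continuous fun p : unitInterval × Circle =>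
        stripMap (ρ * (p.2 : ℂ).re) (ρ * (p.2 : ℂ).im) :=
      continuous_stripMap.comp ((continuous_const.mul (Complex.continuous_re.comp hcoe)).prodMk
        (continuous_const.mul (Complex.continuous_im.comp hcoe)))
    fun_prop
  have hG0 : ∀ p, G p ≠ 0 := by
    rintro ⟨t, c⟩ h
    have ht0 := t.2.1
    have ht1 := t.2.2
    have hc : (c : ℂ).re ^ 2 + (c : ℂ).im ^ 2 = 1 := by
      have := Circle.normSq_coe c
      rw [Complex.normSq_apply] at this
      linarith
    have hre : (1 - (t : ℝ)) * (ρ * (c : ℂ).re + 2 * |ρ * (c : ℂ).im|) + t * (c : ℂ).re = 0 := by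
      simpa [G, stripMap] using congrArg Complex.re h
    have him : (1 - (t : ℝ)) * (ρ * (c : ℂ).im * (max 0 (1 - |ρ * (c : ℂ).im|) *
        max 0 (1 - ρ * (c : ℂ).re))) + t * (c : ℂ).im = 0 := by
      simpa [G, stripMap] using congrArg Complex.im h
    have hcre : |(c : ℂ).re| ≤ 1 := abs_le_one_iff_mul_self_le_one.2 (by nlinarith)
    have hcim : |(c : ℂ).im| ≤ 1 := abs_le_one_iff_mul_self_le_one.2 (by nlinarith)
    have h1 : 0 < max 0 (1 - |ρ * (c : ℂ).im|) := by
      refine lt_max_of_lt_right ?_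
      rw [abs_mul, abs_of_pos hρ]
      nlinarith
    have h2 : 0 < max 0 (1 - ρ * (c : ℂ).re) := by
      refine lt_max_of_lt_right ?_
      have := (abs_le.1 hcre).2
      nlinarith
    set m := max 0 (1 - |ρ * (c : ℂ).im|) * max 0 (1 - ρ * (c : ℂ).re) with hm
    have hm0 : 0 < m := mul_pos h1 h2
    have him0 : (c : ℂ).im = 0 := by
      have h3 : (c : ℂ).im * ((1 - (t : ℝ)) * (ρ * m) + t) = 0 := by linarith
      refine (mul_eq_zero.1 h3).resolve_right (ne_of_gt ?_)
      rcases ht0.eq_or_lt with h4 | h4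
      · rw [← h4]; simp; positivity
      · have : 0 ≤ (1 - (t : ℝ)) * (ρ * m) := mul_nonneg (by linarith) (by positivity)
        linarith
    rw [him0, mul_zero, abs_zero, mul_zero, add_zero] at hre
    have h3 : (c : ℂ).re * ((1 - (t : ℝ)) * ρ + t) = 0 := by linarith
    have hre0 : (c : ℂ).re = 0 := by
      refine (mul_eq_zero.1 h3).resolve_right (ne_of_gt ?_)
      rcases ht0.eq_or_lt with h4 | h4
      · rw [← h4]; simpa using hρ
      · have : 0 ≤ (1 - (t : ℝ)) * ρ := mul_nonneg (by linarith) (by positivity)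
        linarith
    rw [hre0, him0] at hc
    norm_num at hc
  have hhom : k.Homotopic (ContinuousMap.id Circle) :=
    ⟨{ toFun := fun p => toCircle (G p)
       continuous_toFun := continuousOn_toCircle.comp_continuous hG hG0
       map_zero_left := fun c => by simp [G, hk]
       map_one_left := fun c => by simp [G, toCircle_coe] }⟩
  rw [homologyMap_eq_of_homotopic 1 hhom]
  exact homologyMap_one_id_circle_ne_zero

end Surface

/-! ### Interior points of a surface with boundary -/

section Surface

open Metric

/-- The inclusion of the open half-plane in the plane, as a chart of the closed half-plane. -/
def halfPlaneChart : OpenPartialHomeomorph (EuclideanHalfSpace 2) (EuclideanSpace ℝ (Fin 2)) where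
  toFun := Subtype.val
  invFun := (𝓡∂ 2).symm
  source := {z | 0 < z.1 0}
  target := {z | 0 < z 0}
  map_source' z hz := hz
  map_target' z hz := by
    have h : (𝓡∂ 2) ((𝓡∂ 2).symm z) = z := (𝓡∂ 2).right_inv (by
      rw [range_modelWithCornersEuclideanHalfSpace]
      exact le_of_lt (show 0 < z 0 from hz))
    change 0 < ((𝓡∂ 2).symm z).1 0
    rw [show ((𝓡∂ 2).symm z).1 = z from h]
    exact hz
  left_inv' z _ := (𝓡∂ 2).left_inv z
  right_inv' z hz := (𝓡∂ 2).right_inv (by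
    rw [range_modelWithCornersEuclideanHalfSpace]
    exact le_of_lt (show 0 < z 0 from hz))
  open_source := isOpen_lt continuous_const
    ((PiLp.continuous_apply 2 _ 0).comp continuous_subtype_val)
  open_target := isOpen_lt continuous_const (PiLp.continuous_apply 2 _ 0)
  continuousOn_toFun := continuous_subtype_val.continuousOn
  continuousOn_invFun := (𝓡∂ 2).continuous_symm.continuousOn

lemma exists_planeChart {S : Type*} [TopologicalSpace S] [ChartedSpace (EuclideanHalfSpace 2) S]
    {x : S} (hx : 0 < (chartAt (EuclideanHalfSpace 2) x x).1 0) :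
    ∃ ψ : OpenPartialHomeomorph S (EuclideanSpace ℝ (Fin 2)), x ∈ ψ.source :=
  ⟨(chartAt (EuclideanHalfSpace 2) x).trans halfPlaneChart, by
    rw [OpenPartialHomeomorph.trans_source]
    exact ⟨mem_chart_source _ x, hx⟩⟩

lemma dist_le_of_coord_le {x y : EuclideanSpace ℝ (Fin 2)} {η : ℝ} (h0 : |x 0 - y 0| ≤ η)
    (h1 : |x 1 - y 1| ≤ η) : dist x y ≤ 2 * η := by
  have hη : 0 ≤ η := (abs_nonneg _).trans h0
  rw [EuclideanSpace.dist_eq, Fin.sum_univ_two, Real.dist_eq, Real.dist_eq]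
  refine Real.sqrt_le_iff.2 ⟨by positivity, ?_⟩
  have := pow_le_pow_left₀ (abs_nonneg _) h0 2
  have := pow_le_pow_left₀ (abs_nonneg _) h1 2
  nlinarith

lemma coord_le_dist (x y : EuclideanSpace ℝ (Fin 2)) (i : Fin 2) : |x i - y i| ≤ dist x y := by
  rw [dist_eq_norm, ← Real.norm_eq_abs]
  exact PiLp.norm_apply_le (x - y) i

lemma isClosedEmbedding_halfPlane :
    Topology.IsClosedEmbedding (Subtype.val : EuclideanHalfSpace 2 → EuclideanSpace ℝ (Fin 2)) :=
  IsClosed.isClosedEmbedding_subtypeVal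
    (isClosed_le continuous_const (PiLp.continuous_apply 2 _ 0))

/-- A neighbourhood of a point in the half-plane contains a Euclidean half-disc. -/
lemma exists_halfDisc_subset {O : Set (EuclideanHalfSpace 2)} (hO : IsOpen O)
    {z : EuclideanHalfSpace 2} (hz : z ∈ O) :
    ∃ r > 0, ∀ w : EuclideanHalfSpace 2, dist w.1 z.1 < r → w ∈ O := by
  obtain ⟨O', hO', rfl⟩ := isClosedEmbedding_halfPlane.isInducing.isOpen_iff.1 hO
  obtain ⟨r, hr, hball⟩ := Metric.isOpen_iff.1 hO' z.1 hz
  exact ⟨r, hr, fun w hw => hball hw⟩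

/-- The points with positive first coordinate are dense in the half-plane. -/
lemma exists_pos_of_isOpen {O : Set (EuclideanHalfSpace 2)} (hO : IsOpen O) (hne : O.Nonempty) :
    ∃ z ∈ O, 0 < z.1 0 := by
  obtain ⟨z, hz⟩ := hne
  obtain ⟨r, hr, hball⟩ := exists_halfDisc_subset hO hz
  have h0 : 0 ≤ z.1 0 := z.2
  refine ⟨⟨!₂[z.1 0 + r / 4, z.1 1], by simp; linarith⟩, hball _ ?_, by simp; linarith⟩
  refine (dist_le_of_coord_le (η := r / 4) ?_ ?_).trans_lt (by linarith)
  · simp [abs_of_pos (show 0 < r / 4 by positivity)]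
  · simp; positivity

variable {S : Type*} [TopologicalSpace S] [T2Space S]

/-- Near a boundary point, small loops around interior points do not bound: such a loop crosses
exactly once the segment that joins its centre to the boundary, and collapsing the complement of a
strip around this segment gives a map to the circle that detects the loop. -/
theorem exists_nhds_not_loopsBound (e : OpenPartialHomeomorph S (EuclideanHalfSpace 2)) {b : S}
    (hb : b ∈ e.source) (hb0 : (e b).1 0 = 0) :
    ∃ U : Set S, IsOpen U ∧ b ∈ U ∧ U ⊆ e.source ∧ ∀ y ∈ U, 0 < (e y).1 0 → ¬ LoopsBound y := by
  classical
  obtain ⟨r, hr, hball⟩ := exists_halfDisc_subset e.open_target (e.map_source hb)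
  obtain ⟨δ, hδdef⟩ : ∃ δ, δ = r / 8 := ⟨_, rfl⟩
  have hδ : 0 < δ := by rw [hδdef]; positivity
  refine ⟨e.source ∩ e ⁻¹' {z | dist z.1 (e b).1 < δ}, e.isOpen_inter_preimage
    (isOpen_lt (continuous_subtype_val.dist continuous_const) continuous_const),
    ⟨hb, by simpa using hδ⟩, Set.inter_subset_left, ?_⟩
  rintro y ⟨hy, hyb⟩ ha ⟨U, hU, hyU, hloop⟩
  set a := (e y).1 0 with hadef
  set t := (e y).1 1 with htdef
  have haδ : a < δ := by
    have := (coord_le_dist (e y).1 (e b).1 0).trans_lt hyb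
    rw [hb0, sub_zero] at this
    exact (abs_lt.1 this).2
  have htδ : |t - (e b).1 1| < δ := (coord_le_dist (e y).1 (e b).1 1).trans_lt hyb
  -- the strip around the segment from `y` to the boundary
  let T : Set (EuclideanHalfSpace 2) := {z | z.1 0 ≤ a + δ ∧ |z.1 1 - t| ≤ δ}
  have hTdist : ∀ z ∈ T, dist z.1 (e b).1 ≤ 4 * δ := by
    rintro z ⟨h0, h1⟩
    have hz : 0 ≤ z.1 0 := z.2
    refine (dist_le_of_coord_le (η := 2 * δ) ?_ ?_).trans (by linarith)
    · rw [hb0, sub_zero, abs_of_nonneg hz]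
      linarith
    · have := abs_sub_le (z.1 1) t ((e b).1 1)
      linarith
  have hc0 : Continuous fun z : EuclideanHalfSpace 2 => z.1 0 :=
    (PiLp.continuous_apply 2 _ 0).comp continuous_subtype_val
  have hc1 : Continuous fun z : EuclideanHalfSpace 2 => z.1 1 :=
    (PiLp.continuous_apply 2 _ 1).comp continuous_subtype_val
  have hTt : T ⊆ e.target := fun z hz => hball z ((hTdist z hz).trans_lt (by linarith))
  have hT : IsCompact T := by
    refine (isClosedEmbedding_halfPlane.isCompact_preimage
      (isCompact_closedBall (e b).1 (4 * δ))).of_isClosed_subset ?_ fun z hz => hTdist z hz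
    exact (isClosed_le hc0 continuous_const).inter
      (isClosed_le (hc1.sub continuous_const).abs continuous_const)
  have hK : IsCompact (e.symm '' T) := hT.image_of_continuousOn (e.continuousOn_symm.mono hTt)
  let F : EuclideanHalfSpace 2 → ℂ := fun z => stripMap ((z.1 0 - a) / δ) ((z.1 1 - t) / δ)
  have hF : Continuous F := continuous_stripMap.comp
    (((hc0.sub continuous_const).div_const _).prodMk ((hc1.sub continuous_const).div_const _))
  have hu : ∀ z : EuclideanHalfSpace 2, -1 < (z.1 0 - a) / δ := fun z => by
    have hz : 0 ≤ z.1 0 := z.2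
    rw [lt_div_iff₀ hδ]
    linarith
  have hF0 : ∀ z : EuclideanHalfSpace 2, z ≠ e y → F z ≠ 0 := by
    intro z hz
    refine stripMap_ne_zero (hu z) ?_
    by_contra! hcon
    apply hz
    rw [div_eq_zero_iff, div_eq_zero_iff] at hcon
    have h0 := sub_eq_zero.1 (hcon.1.resolve_right hδ.ne')
    have h1 := sub_eq_zero.1 (hcon.2.resolve_right hδ.ne')
    apply Subtype.ext
    ext i
    fin_cases i
    · exact h0
    · exact h1
  have hF1 : ∀ z, z ∉ T → toCircle (F z) = 1 := by
    intro z hz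
    refine toCircle_stripMap (hu z) ?_
    by_contra! hcon
    apply hz
    rw [div_lt_one hδ, abs_div, abs_of_pos hδ, div_lt_one hδ] at hcon
    exact ⟨by linarith [hcon.1], hcon.2.le⟩
  let g : S → Circle := fun s => if s ∈ e.source then toCircle (F (e s)) else 1
  have hg : ContinuousOn g {y}ᶜ := by
    have h1 : ContinuousOn g (e.source ∩ {y}ᶜ) := by
      have : ContinuousOn (fun s => toCircle (F (e s))) (e.source ∩ {y}ᶜ) := by
        refine continuousOn_toCircle.comp
          (hF.comp_continuousOn (e.continuousOn.mono Set.inter_subset_left)) ?_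
        rintro s ⟨hs, hsy⟩
        exact hF0 _ fun heq => hsy (e.injOn hs hy heq)
      exact this.congr fun s hs => if_pos hs.1
    have h2 : ContinuousOn g (e.symm '' T)ᶜ := by
      refine (continuousOn_const (c := (1 : Circle))).congr fun s hs => ?_
      by_cases hs' : s ∈ e.source
      · have h3 : g s = toCircle (F (e s)) := if_pos hs'
        rw [h3]
        exact hF1 _ fun hmem => hs ⟨_, hmem, e.left_inv hs'⟩
      · exact if_neg hs'
    refine (h1.union_of_isOpen h2 (e.open_source.inter isOpen_compl_singleton)
      hK.isClosed.isOpen_compl).mono fun s hs => ?_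
    by_cases hs' : s ∈ e.source
    · exact Or.inl ⟨hs', hs⟩
    · refine Or.inr ?_
      rintro ⟨z, hz, rfl⟩
      exact hs' (e.map_target (hTt hz))
  -- a circle around `y` inside `U` and inside the strip
  obtain ⟨η, hη, hηball⟩ := exists_halfDisc_subset
    (e.isOpen_inter_preimage_symm hU) (z := e y) ⟨e.map_source hy, by
      rw [Set.mem_preimage, e.left_inv hy]; exact hyU⟩
  obtain ⟨ρ, hρdef⟩ : ∃ ρ, ρ = min (η / 4) (a / 2) / δ := ⟨_, rfl⟩
  have hmin : 0 < min (η / 4) (a / 2) := lt_min (by positivity) (by positivity)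
  have hρ : 0 < ρ := by rw [hρdef]; positivity
  have hρδ : ρ * δ = min (η / 4) (a / 2) := by rw [hρdef, div_mul_cancel₀ _ hδ.ne']
  have hρη : ρ * δ ≤ η / 4 := hρδ ▸ min_le_left _ _
  have hρa : ρ * δ ≤ a / 2 := hρδ ▸ min_le_right _ _
  have hρ1 : ρ < 1 := by
    by_contra! h
    nlinarith
  have hre : ∀ c : Circle, |(c : ℂ).re| ≤ 1 := fun c =>
    (Complex.abs_re_le_norm _).trans (Circle.norm_coe c).le
  have him : ∀ c : Circle, |(c : ℂ).im| ≤ 1 := fun c =>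
    (Complex.abs_im_le_norm _).trans (Circle.norm_coe c).le
  let ℓ : Circle → EuclideanHalfSpace 2 := fun c =>
    ⟨!₂[a + ρ * δ * (c : ℂ).re, t + ρ * δ * (c : ℂ).im], by
      have := (abs_le.1 (hre c)).1
      simp
      nlinarith⟩
  have hcoe : Continuous fun c : Circle => (c : ℂ) := continuous_induced_dom
  have hℓ : Continuous ℓ := by
    refine Continuous.subtype_mk ?_ _
    refine (PiLp.continuous_toLp 2 _).comp (continuous_pi fun i => ?_)
    fin_cases i
    · exact continuous_const.add (continuous_const.mul (Complex.continuous_re.comp hcoe))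
    · exact continuous_const.add (continuous_const.mul (Complex.continuous_im.comp hcoe))
  have hℓ0 : ∀ c, (ℓ c).1 0 = a + ρ * δ * (c : ℂ).re := fun c => rfl
  have hℓ1 : ∀ c, (ℓ c).1 1 = t + ρ * δ * (c : ℂ).im := fun c => rfl
  have hℓU : ∀ c, ℓ c ∈ e.target ∩ e.symm ⁻¹' U := by
    intro c
    refine hηball _ ((dist_le_of_coord_le (η := η / 4) ?_ ?_).trans_lt (by linarith))
    · rw [hℓ0, ← hadef, add_sub_cancel_left, abs_mul, abs_of_pos (by positivity)]
      have := hre c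
      nlinarith [abs_nonneg (c : ℂ).re]
    · rw [hℓ1, ← htdef, add_sub_cancel_left, abs_mul, abs_of_pos (by positivity)]
      have := him c
      nlinarith [abs_nonneg (c : ℂ).im]
  have hFℓ : ∀ c, F (ℓ c) = stripMap (ρ * (c : ℂ).re) (ρ * (c : ℂ).im) := by
    intro c
    simp only [F, hℓ0, hℓ1, add_sub_cancel_left]
    congr 1 <;> field_simp
  have hℓy : ∀ c, ℓ c ≠ e y := by
    intro c heq
    have h0 : (c : ℂ).re = 0 := by
      have h : a + ρ * δ * (c : ℂ).re = a := congrArg (fun z : EuclideanHalfSpace 2 => z.1 0) heq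
      have : ρ * δ * (c : ℂ).re = 0 := by linarith
      exact (mul_eq_zero.1 this).resolve_left (by positivity)
    have h1 : (c : ℂ).im = 0 := by
      have h : t + ρ * δ * (c : ℂ).im = t := congrArg (fun z : EuclideanHalfSpace 2 => z.1 1) heq
      have : ρ * δ * (c : ℂ).im = 0 := by linarith
      exact (mul_eq_zero.1 this).resolve_left (by positivity)
    exact c.coe_ne_zero (Complex.ext h0 h1)
  let γ : C(Circle, S) := ⟨fun c => e.symm (ℓ c),
    e.continuousOn_symm.comp_continuous hℓ fun c => (hℓU c).1⟩
  let k : C(Circle, Circle) := ⟨fun c => toCircle (F (ℓ c)),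
    continuousOn_toCircle.comp_continuous (hF.comp hℓ) fun c => hF0 _ (hℓy c)⟩
  refine homologyMap_stripMap_ne_zero hρ hρ1 k (fun c => congrArg toCircle (hFℓ c))
    (hloop γ (fun c => ⟨(hℓU c).2, fun heq => hℓy c ?_⟩) g hg k fun c => ?_)
  · rw [← heq]
    exact (e.right_inv (hℓU c).1).symm
  · have h1 : g (γ c) = toCircle (F (e (γ c))) := if_pos (e.map_target (hℓU c).1)
    rw [h1]
    exact congrArg (fun z => toCircle (F z)) (e.right_inv (hℓU c).1).symm

/-- In a connected surface with boundary, small loops around an interior point do not bound in the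
complement of that point: the property spreads from a point to its component in the interior,
because charts allow to move points around, and it fails near the boundary. -/
theorem not_loopsBound [ConnectedSpace S] [ChartedSpace (EuclideanHalfSpace 2) S] {b x : S}
    (hb : (chartAt (EuclideanHalfSpace 2) b b).1 0 = 0)
    (hx : 0 < (chartAt (EuclideanHalfSpace 2) x x).1 0) : ¬ LoopsBound x := by
  intro hbound
  set A : Set S := interior {y | LoopsBound y} with hA
  have hAsub : ∀ y ∈ A, LoopsBound y := fun y hy =>
    interior_subset (s := {y | LoopsBound y}) hy
  have hspread : ∀ z : S, 0 < (chartAt (EuclideanHalfSpace 2) z z).1 0 →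
      ∃ U : Set S, IsOpen U ∧ z ∈ U ∧ ∀ y ∈ U, LoopsBound y → U ⊆ A := by
    intro z hz
    obtain ⟨ψ, hψ⟩ := exists_planeChart hz
    obtain ⟨U, hU, hzU, hmove⟩ := exists_homeomorph_of_mem_chart ψ hψ
    refine ⟨U, hU, hzU, fun y hy hyb => interior_maximal (fun y' hy' => ?_) hU⟩
    obtain ⟨H, rfl⟩ := hmove y hy y' hy'
    exact hyb.image H
  have hbdry : ∀ z : S, (chartAt (EuclideanHalfSpace 2) z z).1 0 = 0 → z ∉ closure A := by
    intro z hz hzA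
    set e := chartAt (EuclideanHalfSpace 2) z with he
    obtain ⟨U, hU, hzU, hUe, hnot⟩ := exists_nhds_not_loopsBound e (mem_chart_source _ z) hz
    obtain ⟨y, hyU, hyA⟩ := mem_closure_iff.1 hzA U hU hzU
    have hUA : IsOpen (U ∩ A) := hU.inter isOpen_interior
    obtain ⟨w, ⟨hw, hwU, hwA⟩, hw0⟩ := exists_pos_of_isOpen (e.isOpen_inter_preimage_symm hUA)
      ⟨e y, e.map_source (hUe hyU), by
        rw [Set.mem_preimage, e.left_inv (hUe hyU)]; exact ⟨hyU, hyA⟩⟩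
    exact hnot _ hwU (by rwa [e.right_inv hw]) (hAsub _ hwA)
  have hclopen : IsClopen A := by
    refine ⟨isClosed_of_closure_subset fun z hz => ?_, isOpen_interior⟩
    have hz0 : 0 ≤ (chartAt (EuclideanHalfSpace 2) z z).1 0 :=
      (chartAt (EuclideanHalfSpace 2) z z).2
    rcases hz0.eq_or_lt with h | h
    · exact absurd hz (hbdry z h.symm)
    · obtain ⟨U, hU, hzU, hspr⟩ := hspread z h
      obtain ⟨y, hyU, hyA⟩ := mem_closure_iff.1 hz U hU hzU
      exact hspr y hyU (hAsub y hyA) hzU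
  have hxA : x ∈ A := by
    obtain ⟨U, hU, hxU, hspr⟩ := hspread x hx
    exact hspr x hxU hbound hxU
  have hbA : b ∈ A := by
    rw [hclopen.eq_univ ⟨x, hxA⟩]
    trivial
  exact hbdry b hb (subset_closure hbA)

end Surface

/-! ### Tight polyhedral embeddings -/

section Tight

variable {S : Type*} [TopologicalSpace S] {n : ℕ} {φ : S → EuclideanSpace ℝ (Fin n)}

lemma setOf_lt_eq_openHalfSpace (f : EuclideanSpace ℝ (Fin n) →L[ℝ] ℝ) (c : ℝ) :
    {y | c < f y} = openHalfSpace ((InnerProductSpace.toDual ℝ _).symm f) c := by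
  ext y
  simp [openHalfSpace]

/-- A `0`-tight connected set has the two-piece property. -/
lemma isPreconnected_inter_halfSpace_of_isPTight {S : Type*} {φ : S → EuclideanSpace ℝ (Fin n)}
    (hM : IsPathConnected (Set.range φ))
    (h : IsPTight 0 φ) (f : EuclideanSpace ℝ (Fin n) →L[ℝ] ℝ) (c : ℝ) :
    IsPreconnected (Set.range φ ∩ {y | c < f y}) := by
  rw [setOf_lt_eq_openHalfSpace]
  by_cases hv : (InnerProductSpace.toDual ℝ _).symm f = 0
  · rw [hv]
    by_cases hc : c < 0
    · have : openHalfSpace (0 : EuclideanSpace ℝ (Fin n)) c = Set.univ := by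
        ext; simp [openHalfSpace, hc]
      rw [this, Set.inter_univ]
      exact hM.isConnected.isPreconnected
    · have : openHalfSpace (0 : EuclideanSpace ℝ (Fin n)) c = ∅ := by
        ext; simp [openHalfSpace, hc]
      rw [this, Set.inter_empty]
      exact isPreconnected_empty
  · exact isPreconnected_of_homologyInclusion_zero_injective _ hM (h _ c hv)

/-- Let a chart of a `1`-tight set be centred at a point that a linear function exposes. A small
loop around this point contracts in the chart, and by tightness it already bounds in the part of
the set where the function is smaller. -/
lemma loopsBound_of_isPTight (hφ : Topology.IsEmbedding φ) (h : IsPTight 1 φ) {x : S}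
    (ψ : OpenPartialHomeomorph S (EuclideanSpace ℝ (Fin 2))) (hx : x ∈ ψ.source)
    {f : EuclideanSpace ℝ (Fin n) →L[ℝ] ℝ} (hf : f ≠ 0)
    (hfx : ∀ y, y ≠ x → f (φ y) < f (φ x)) : LoopsBound x := by
  obtain ⟨r, hr, hball⟩ := Metric.isOpen_iff.1 ψ.open_target _ (ψ.map_source hx)
  refine ⟨ψ.source ∩ ψ ⁻¹' Metric.ball (ψ x) r, ψ.isOpen_inter_preimage Metric.isOpen_ball,
    ⟨hx, Metric.mem_ball_self hr⟩, fun γ hγ g hg k hk => ?_⟩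
  -- the loop stays in a half-space that does not contain the image of `x`
  obtain ⟨c, hc, hcγ⟩ : ∃ c < f (φ x), ∀ u, f (φ (γ u)) < c := by
    obtain ⟨u, -, hu⟩ := isCompact_univ.exists_isMaxOn (Set.univ_nonempty (α := Circle))
      ((f.continuous.comp (hφ.continuous.comp γ.continuous)).continuousOn)
    obtain ⟨c, hc1, hc2⟩ := exists_between (hfx (γ u) (hγ u).2)
    exact ⟨c, hc2, fun u' => (hu (Set.mem_univ u')).trans_lt hc1⟩
  set E := openHalfSpace ((InnerProductSpace.toDual ℝ _).symm (-f)) (-c) with hE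
  have hE' : ∀ y, y ∈ E ↔ f y < c := fun y => by
    rw [hE, ← setOf_lt_eq_openHalfSpace]
    simp
  have hinj := h _ (-c) (by simpa using hf : (InnerProductSpace.toDual ℝ _).symm (-f) ≠ 0)
  set N : Set (EuclideanSpace ℝ (Fin n)) := Set.range φ ∩ E with hN
  have hmono : CategoryTheory.Mono
      (homologyInclusion (Set.inter_subset_left : N ⊆ Set.range φ) 1) :=
    (ModuleCat.mono_iff_injective _).2 hinj
  let γ' : C(Circle, N) := ⟨fun u => ⟨φ (γ u), ⟨γ u, rfl⟩, (hE' _).2 (hcγ u)⟩,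
    (hφ.continuous.comp γ.continuous).subtype_mk _⟩
  have hnull : ((⟨Set.inclusion Set.inter_subset_left, continuous_inclusion _⟩ :
      C(N, Set.range φ)).comp γ').Nullhomotopic := by
    let G : unitInterval × Circle → EuclideanSpace ℝ (Fin 2) := fun p =>
      (1 - (p.1 : ℝ)) • ψ (γ p.2) + (p.1 : ℝ) • ψ x
    have hψγ : Continuous fun u => ψ (γ u) :=
      ψ.continuousOn.comp_continuous γ.continuous fun u => (hγ u).1.1
    have hG : Continuous G := by
      have := hψγ.comp (continuous_snd (X := unitInterval))
      have h2 : Continuous fun p : unitInterval × Circle => (p.1 : ℝ) := by fun_prop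
      exact ((continuous_const.sub h2).smul this).add (h2.smul continuous_const)
    have hGt : ∀ p, G p ∈ ψ.target := fun p => hball
      ((convex_ball (ψ x) r) (hγ p.2).1.2 (Metric.mem_ball_self hr) (by have := p.1.2.2; linarith)
        p.1.2.1 (by ring))
    refine ⟨⟨φ x, x, rfl⟩, ⟨{
      toFun := fun p => ⟨φ (ψ.symm (G p)), _, rfl⟩
      continuous_toFun := (hφ.continuous.comp
        (ψ.continuousOn_symm.comp_continuous hG hGt)).subtype_mk _
      map_zero_left := fun u => Subtype.ext ?_
      map_one_left := fun u => Subtype.ext ?_ }⟩⟩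
    · simp only [G, γ']
      simp [ψ.left_inv (hγ u).1.1]
    · simp only [G]
      simp [ψ.left_inv hx]
  have hzero : homologyMap 1 γ' = 0 := by
    rw [← CategoryTheory.cancel_mono
      (homologyInclusion (Set.inter_subset_left : N ⊆ Set.range φ) 1),
      CategoryTheory.Limits.zero_comp]
    exact (homologyMap_comp 1 _ γ').symm.trans (homologyMap_one_of_nullhomotopic hnull)
  let σ : S ≃ₜ Set.range φ := hφ.toHomeomorph
  have hσ : ∀ y : N, σ.symm ⟨y, y.2.1⟩ ≠ x := by
    intro y heq
    have h1 : (⟨y, y.2.1⟩ : Set.range φ) = σ x := σ.symm_apply_eq.1 heq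
    have h2 : (y : EuclideanSpace ℝ (Fin n)) = φ x := congrArg Subtype.val h1
    have h3 := (hE' _).1 y.2.2
    rw [h2] at h3
    linarith
  let g' : C(N, Circle) := ⟨fun y => g (σ.symm ⟨y, y.2.1⟩),
    hg.comp_continuous (σ.symm.continuous.comp (continuous_subtype_val.subtype_mk _)) hσ⟩
  have hkg : k = g'.comp γ' := by
    ext u
    rw [hk u]
    have : σ.symm ⟨φ (γ u), ⟨γ u, rfl⟩⟩ = γ u := σ.symm_apply_apply (γ u)
    exact congrArg (fun s => (g s : ℂ)) this.symm
  rw [hkg, homologyMap_comp, hzero, CategoryTheory.Limits.zero_comp]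

/-- The vertices of a finite simplicial complex span a polytope that contains the complex. -/
lemma exists_finset_of_isPolyhedralEmbedding (h : IsPolyhedralEmbedding φ) :
    ∃ V : Finset (EuclideanSpace ℝ (Fin n)), (V : Set (EuclideanSpace ℝ (Fin n))) ⊆ Set.range φ ∧
      Set.range φ ⊆ convexHull ℝ (V : Set (EuclideanSpace ℝ (Fin n))) := by
  obtain ⟨-, K, hfin, hK⟩ := h
  have hV : K.vertices.Finite := by
    refine Set.Finite.of_finite_image (f := fun x => ({x} : Finset _)) (hfin.subset ?_)
      (Finset.singleton_injective.injOn)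
    rintro _ ⟨x, hx, rfl⟩
    exact hx
  refine ⟨hV.toFinset, ?_, ?_⟩
  · rw [hV.coe_toFinset, ← hK]
    exact K.vertices_subset_space
  · rw [hV.coe_toFinset, ← hK]
    intro x hx
    obtain ⟨s, hs, hxs⟩ := K.mem_space_iff.1 hx
    refine convexHull_mono ?_ hxs
    rw [Geometry.SimplicialComplex.vertices_eq]
    exact Set.subset_biUnion_of_mem
      (u := fun k : Finset (EuclideanSpace ℝ (Fin n)) => (k : Set (EuclideanSpace ℝ (Fin n)))) hs

/-- The vertices of the convex hull of a tight surface with boundary lie on the boundary. -/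
lemma mem_boundary_of_mem_skeleton_zero [T2Space S] [ConnectedSpace S]
    [ChartedSpace (EuclideanHalfSpace 2) S] (hboundary : ((𝓡∂ 2).boundary S).Nonempty)
    (hφ : Topology.IsEmbedding φ) (h : IsPTight 1 φ)
    {V : Finset (EuclideanSpace ℝ (Fin n))}
    (hV : Set.range φ ⊆ convexHull ℝ (V : Set (EuclideanSpace ℝ (Fin n)))) {x : S}
    (hx : φ x ∈ skeleton 0 (convexHull ℝ (V : Set (EuclideanSpace ℝ (Fin n))))) :
    x ∈ (𝓡∂ 2).boundary S := by
  have hbd : ∀ y : S, y ∈ (𝓡∂ 2).boundary S ↔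
      0 = (chartAt (EuclideanHalfSpace 2) y y).1 0 := by
    intro y
    change extChartAt (𝓡∂ 2) y y ∈ frontier (Set.range (𝓡∂ 2)) ↔ _
    rw [frontier_range_modelWithCornersEuclideanHalfSpace]
    rfl
  obtain ⟨b, hb⟩ := hboundary
  rw [hbd] at hb ⊢
  by_contra hne
  have hpos : 0 < (chartAt (EuclideanHalfSpace 2) x x).1 0 :=
    lt_of_le_of_ne (chartAt (EuclideanHalfSpace 2) x x).2 hne
  have hbot : faceDir (convexHull ℝ (V : Set (EuclideanSpace ℝ (Fin n)))) (φ x) = ⊥ :=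
    Submodule.finrank_eq_zero.1 (Nat.le_zero.1 hx.2)
  obtain ⟨f, hf⟩ := exists_exposing_functional hx.1
  have hfx : ∀ y, y ≠ x → f (φ y) < f (φ x) := by
    intro y hy
    obtain ⟨h1, h2⟩ := hf (φ y) (hV ⟨y, rfl⟩)
    refine lt_of_le_of_ne h1 fun heq => hy (hφ.injective ?_)
    have := h2 heq
    rw [hbot, Submodule.mem_bot, sub_eq_zero] at this
    exact this
  have hbx : b ≠ x := by
    rintro rfl
    exact hne hb
  have hf0 : f ≠ 0 := by
    rintro rfl
    exact absurd (hfx b hbx) (by simp)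
  obtain ⟨ψ, hψ⟩ := exists_planeChart hpos
  exact not_loopsBound hb.symm hpos (loopsBound_of_isPTight hφ h ψ hψ hf0 hfx)

end Tight

end TightSurface

end

theorem mainTheorem1 {S : Type*} [TopologicalSpace S] [T2Space S] [CompactSpace S]
    [ConnectedSpace S] [ChartedSpace (EuclideanHalfSpace 2) S]
    (hboundary : ((modelWithCornersEuclideanHalfSpace 2).boundary S).Nonempty)
    (n : ℕ) (φ : S → EuclideanSpace ℝ (Fin n))
    (hpoly : TightSurface.IsPolyhedralEmbedding φ)
    (hsubst : TightSurface.IsSubstantial φ)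
    (htight : TightSurface.IsTight φ) :
    (n : ℕ∞) + 1 ≤ TightSurface.relativeChromaticNumber S := by
  have hφ := hpoly.1
  obtain ⟨V, hVM, hMV⟩ := TightSurface.exists_finset_of_isPolyhedralEmbedding hpoly
  have hcompact : IsCompact (Set.range φ) := isCompact_range hφ.continuous
  have hlpc : LocallyPathConnectedSpace S :=
    ChartedSpace.locallyPathConnectedSpace (EuclideanHalfSpace 2) S
  have hpc : PathConnectedSpace S := pathConnectedSpace_iff_connectedSpace.2 inferInstance
  have hpath : IsPathConnected (Set.range φ) := isPathConnected_range hφ.continuous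
  have hskel := TightSurface.skeleton_one_subset hcompact
    (TightSurface.isPreconnected_inter_halfSpace_of_isPTight hpath (htight 0)) hVM hMV
  have hVne : V.Nonempty := by
    obtain ⟨x⟩ := (inferInstance : Nonempty S)
    have : (convexHull ℝ (V : Set (EuclideanSpace ℝ (Fin n)))).Nonempty := ⟨_, hMV ⟨x, rfl⟩⟩
    simpa using this
  have hdim : n ≤ Module.finrank ℝ (vectorSpan ℝ (V : Set (EuclideanSpace ℝ (Fin n)))) := by
    have htop : affineSpan ℝ (V : Set (EuclideanSpace ℝ (Fin n))) = ⊤ := by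
      rw [eq_top_iff, ← hsubst, affineSpan_le]
      exact hMV.trans (convexHull_subset_affineSpan _)
    rw [← direction_affineSpan, htop, AffineSubspace.direction_top, finrank_top]
    simp
  obtain ⟨ι, hι, hcard, f, hf⟩ := TightSurface.exists_completeGraph_skeleton n V hVne hdim
  let σ : S ≃ₜ Set.range φ := hφ.toHomeomorph
  let g : TightSurface.skeleton 1 (convexHull ℝ (V : Set (EuclideanSpace ℝ (Fin n)))) → S :=
    fun p => σ.symm ⟨p, hskel p.2⟩
  have hφg : ∀ p, φ (g p) = p := fun p => congrArg Subtype.val (σ.apply_symm_apply ⟨p, hskel p.2⟩)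
  have hg : Continuous g := σ.symm.continuous.comp (continuous_subtype_val.subtype_mk _)
  have hginj : Function.Injective g := fun p q h => Subtype.ext (by rw [← hφg p, h, hφg])
  have hemb : TightSurface.ProperlyEmbeds (⊤ : SimpleGraph (Fin (n + 1))) S :=
    ⟨(f.map g hg hginj).relabel (Fintype.equivFinOfCardEq hcard).symm, fun v =>
      TightSurface.mem_boundary_of_mem_skeleton_zero hboundary hφ (htight 1) hMV
        ((hφg _).symm ▸ hf _)⟩
  refine le_iSup_of_le (n + 1) (le_iSup_of_le ⊤ (le_iSup_of_le hemb ?_))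
  simp [SimpleGraph.chromaticNumber_top]
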